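/- Let $G$ be a real Lie group of dimension $d$ (for instance a matrix Lie group) with identity $e$, Lie algebra $\mathfrak g=T_eG$, exponential map $\exp:\mathfrak g\to G$, left translations $\Phi_q(h)=qh$ and adjoint action $\mathrm{Ad}_g:\mathfrak g\to\mathfrak g$. Fix $N\in\mathbb N$, an open neighbourhood $O_e$ of $e$ in $G$, an open set $\mathcal O\subset\mathfrak g$ such that $\exp:\mathcal O\to\exp(\mathcal O)$ is a diffeomorphism onto an open subset of $G$ (with inverse denoted $\exp^{-1}$), end points $(\bar q_0,\bar x_0),(\bar q_N,\bar x_N)\in G\times\mathbb R^{n_x}$, convex sets $\mathbb U_t\subset\mathbb R^{n_u}$, and smooth maps $$c_t:O_e\times G\times\mathbb R^{n_x}\times\mathbb R^{n_u}\to\mathbb R,\qquad f_t:O_e\times G\times\mathbb R^{n_x}\times\mathbb R^{n_u}\to\mathbb R^{n_x},\qquad v_t:O_e\times G\times\mathbb R^{n_x}\to\mathbb R^{d}\qquad(t=0,\dots,N-1).$$ Consider the problem of minimizing $\sum_{t=0}^{N-1}c_t(s_t,q_t,x_t,u_t)$ subject to $$q_{t+1}=q_ts_t,\quad v_t(s_t,q_t,x_t)=0,\quad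 x_{t+1}=f_t(s_t,q_t,x_t,u_t),\quad u_t\in\mathbb U_t,\quad s_t\in O_e\cap\exp(\mathcal O)\qquad(t=0,\dots,N-1),$$ $$(q_0,x_0)=(\bar q_0,\bar x_0),\qquad (q_N,x_N)=(\bar q_N,\bar x_N).$$ Assume that for every trajectory satisfying these constraints and every $t=0,\dots,N-1$ the map $v_t(\cdot,q_t,x_t):O_e\to\mathbb R^{d}$ is a diffeomorphism onto its (open) image. Let $\{u_t\}_{t=0}^{N-1}$ be an optimal controller, with corresponding states $\{(q_t,x_t)\}_{t=0}^N$ and integration steps $\{s_t\}_{t=0}^{N-1}$. For $\nu\in\mathbb R$, $\zeta\in\mathfrak g^*$, $\xi\in(\mathbb R^{n_x})^*$ define the Hamiltonian $$H^\nu(t,\zeta,\xi,s,q,x,u)=\nu\,c_t(s,q,x,u)+\langle\zeta,\exp^{-1}(s)\rangle+\langle\xi,f_t(s,q,x,u)\rangle .$$ Then there exist $\{(\zeta^t,\xi^t)\}_{t=0}^{N-1}\subset\mathfrak g^*\times(\mathbb R^{n_x})^*$ and $\nu\in\{-1,0\}$ such that, with $\gamma_t=(t,\zeta^t,\xi^t,s_t,q_t,x_t,u_t)$,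 with all derivatives of $v_t$ taken at $(s_t,q_t,x_t)$, and with $$\rho^t=\Big(\mathcal D\exp^{-1}\big(e^{\mathcal D_\zeta H^\nu(\gamma_t)}\big)\circ T_e\Phi_{e^{\mathcal D_\zeta H^\nu(\gamma_t)}}\Big)^*(\zeta^t)\in\mathfrak g^*,$$ the following hold: (i) state dynamics, for $t=0,\dots,N-1$: $q_{t+1}=q_t\,e^{\mathcal D_\zeta H^\nu(\gamma_t)}$, $\;v_t(s_t,q_t,x_t)=0$, $\;x_{t+1}=\mathcal D_\xi H^\nu(\gamma_t)$; and adjoint dynamics, for $t=1,\dots,N-1$: $$\rho^{t-1}=\mathrm{Ad}^*_{e^{-\mathcal D_\zeta H^\nu(\gamma_t)}}\rho^t+T_e^*\Phi_{q_t}\big(\mathcal D_qH^\nu(\gamma_t)\big)-T_e^*\Phi_{q_t}\big(\mathcal D_sH^\nu(\gamma_t)\circ(\mathcal D_sv_t)^{-1}\circ\mathcal D_qv_t\big),$$ $$\xi^{t-1}=-\mathcal D_sH^\nu(\gamma_t)\circ(\mathcal D_sv_t)^{-1}\circ\mathcal D_xv_t+\mathcal D_xH^\nu(\gamma_t);$$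 (ii) Hamiltonian non-positive gradient condition: $\langle\mathcal D_uH^\nu(\gamma_t),w-u_t\rangle\le0$ for all $w\in\mathbb U_t$ and $t=0,\dots,N-1$; (iii) non-triviality: $\nu$ and the adjoint variables $\{(\zeta^t,\xi^t)\}_{t=0}^{N-1}$ do not all vanish. Here $\mathrm{Ad}_g^*$ and $T_e^*\Phi_q$ are the duals: $\langle \mathrm{Ad}_g^*a,\beta\rangle=\langle a,\mathrm{Ad}_g\beta\rangle$ and $\langle T_e^*\Phi_q(a),\beta\rangle=\langle a,T_e\Phi_q(\beta)\rangle$, and $\mathcal D_\zeta H^\nu\in\mathfrak g^{**}=\mathfrak g$, $\mathcal D_\xi H^\nu\in(\mathbb R^{n_x})^{**}=\mathbb R^{n_x}$. -/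

import Mathlib

open Set
open scoped Manifold ContDiff

noncomputable section

/-- The Euclidean space of dimension `n`. -/
abbrev RSp (n : ℕ) : Type := EuclideanSpace ℝ (Fin n)

/-- A smooth diffeomorphism of the open set `s` onto its (open) image `f '' s`. -/
def IsDiffeoOntoImage {E H M E' H' M' : Type*}
    [NormedAddCommGroup E] [NormedSpace ℝ E] [TopologicalSpace H]
    [NormedAddCommGroup E'] [NormedSpace ℝ E'] [TopologicalSpace H']
    (I : ModelWithCorners ℝ E H) (J : ModelWithCorners ℝ E' H')
    [TopologicalSpace M] [ChartedSpace H M] [TopologicalSpace M'] [ChartedSpace H' M']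
    (f : M → M') (s : Set M) : Prop :=
  IsOpen s ∧ IsOpen (f '' s) ∧ ContMDiffOn I J ∞ f s ∧
    ∃ g : M' → M, LeftInvOn g f s ∧ ContMDiffOn J I ∞ g (f '' s)

/-- For a real function `F` on the dual space of `ℝⁿ`, the derivative of `F` at `p` is an element of
the double dual; this is the corresponding vector of `ℝⁿ`. -/
def dualGradient {n : ℕ} (F : (RSp n →L[ℝ] ℝ) → ℝ) (p : RSp n →L[ℝ] ℝ) : RSp n :=
  Function.invFun (NormedSpace.inclusionInDoubleDual ℝ (RSp n)) (fderiv ℝ F p)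

/-! ### Lie groups

A Lie group `G` of dimension `d` is modelled on `ℝᵈ`, so each tangent space `T_g G`
(`TangentSpace (𝓡 d) g`), and in particular the Lie algebra `T_e G`
(`GroupLieAlgebra (𝓡 d) G`), is a copy of `ℝᵈ = RSp d`. -/

section Lie

variable {d : ℕ} {G : Type*} [TopologicalSpace G] [ChartedSpace (RSp d) G] [Group G]

/-- `γ : ℝ → G` is a one-parameter subgroup with velocity `X` at time zero. -/
def IsOneParamSubgroup (X : RSp d) (γ : ℝ → G) : Prop :=
  γ 0 = 1 ∧ (∀ a b : ℝ, γ (a + b) = γ a * γ b) ∧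
    HasMFDerivAt 𝓘(ℝ, ℝ) (𝓡 d) γ 0 (ContinuousLinearMap.toSpanSingleton ℝ X)

open Classical in
/-- The exponential map of a Lie group, `exp X = γ 1` for the one-parameter subgroup `γ` with
velocity `X` (which exists and is unique in every Lie group). -/
def lieExp (X : RSp d) : G :=
  if h : ∃ γ : ℝ → G, IsOneParamSubgroup X γ then h.choose 1 else 1

/-- The inverse of the exponential map restricted to `O`. -/
def lieLog (O : Set (RSp d)) : G → RSp d :=
  Function.invFunOn (lieExp : RSp d → G) O

/-- The tangent map at the identity of the left translation by `q`. -/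
def tangentLeft (q : G) : RSp d →L[ℝ] RSp d :=
  mfderiv (𝓡 d) (𝓡 d) (fun h : G => q * h) 1

/-- The adjoint action `Ad_g`, the derivative at the identity of `h ↦ g h g⁻¹`. -/
def lieAd (g : G) : RSp d →L[ℝ] RSp d :=
  mfderiv (𝓡 d) (𝓡 d) (fun h : G => g * h * g⁻¹) 1

/-- The derivative at `g` of a real or vector valued function on `G`, a linear map on `T_g G`. -/
def groupDeriv {m : Type*} [NormedAddCommGroup m] [NormedSpace ℝ m] (F : G → m) (g : G) :
    RSp d →L[ℝ] m :=
  mfderiv (𝓡 d) 𝓘(ℝ, m) F g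

/-- The linear map `D(exp⁻¹)(h) ∘ T_e Φ_h` of the Lie algebra, with `Φ_h` the left translation;
its dual is the map sending `ζᵗ` to `ρᵗ`. -/
def dLog (O : Set (RSp d)) (h : G) : RSp d →L[ℝ] RSp d :=
  (groupDeriv (lieLog O) h).comp (tangentLeft h)

end Lie

/-! ### The optimal control problem -/

/-- Data of the discrete-time optimal control problem on `G × ℝ^nx` with controls in `ℝ^nu` and an
integration step `s_t` given implicitly by `v_t (s_t, q_t, x_t) = 0`. -/
structure ImplicitProblem (d nx nu : ℕ) (G : Type*) where
  /-- the horizon -/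
  N : ℕ
  /-- the stage costs `c_t (s, q, x, u)` -/
  c : ℕ → G → G → RSp nx → RSp nu → ℝ
  /-- the dynamics `f_t (s, q, x, u)` on the Euclidean space -/
  f : ℕ → G → G → RSp nx → RSp nu → RSp nx
  /-- the maps `v_t (s, q, x)` defining the integration step -/
  v : ℕ → G → G → RSp nx → RSp d
  /-- the sets of feasible control actions -/
  U : ℕ → Set (RSp nu)
  /-- the initial and the final states -/
  qInit : G
  xInit : RSp nx
  qFin : G
  xFin : RSp nx
  /-- the neighbourhood of the identity on which `v_t (·, q, x)` is considered -/
  Oe : Set G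
  /-- the open subset of the Lie algebra on which the exponential map is inverted -/
  O : Set (RSp d)

namespace ImplicitProblem

variable {d nx nu : ℕ} {G : Type*} [TopologicalSpace G] [ChartedSpace (RSp d) G] [Group G]

/-- The constraints of the problem. The integration step lies in the domain `Oe` of
`v_t (·, q, x)` and in `exp O`. Only `s_t, u_t` with `t < N` and `q_t, x_t` with `t ≤ N` matter. -/
structure Feasible (P : ImplicitProblem d nx nu G) (s q : ℕ → G) (x : ℕ → RSp nx)
    (u : ℕ → RSp nu) : Prop where
  step_mem : ∀ t < P.N, s t ∈ P.Oe
  step_mem_exp : ∀ t < P.N, s t ∈ (lieExp : RSp d → G) '' P.O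
  step_eq : ∀ t < P.N, P.v t (s t) (q t) (x t) = 0
  q_succ : ∀ t < P.N, q (t + 1) = q t * s t
  x_succ : ∀ t < P.N, x (t + 1) = P.f t (s t) (q t) (x t) (u t)
  control : ∀ t < P.N, u t ∈ P.U t
  q_init : q 0 = P.qInit
  x_init : x 0 = P.xInit
  q_fin : q P.N = P.qFin
  x_fin : x P.N = P.xFin

/-- The performance index. -/
def cost (P : ImplicitProblem d nx nu G) (s q : ℕ → G) (x : ℕ → RSp nx) (u : ℕ → RSp nu) : ℝ :=
  ∑ t ∈ Finset.range P.N, P.c t (s t) (q t) (x t) (u t)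

/-- `u` is an optimal controller, with corresponding integration steps `s` and states `q, x`. -/
def IsOptimal (P : ImplicitProblem d nx nu G) (s q : ℕ → G) (x : ℕ → RSp nx)
    (u : ℕ → RSp nu) : Prop :=
  P.Feasible s q x u ∧
    ∀ (s' q' : ℕ → G) (x' : ℕ → RSp nx) (u' : ℕ → RSp nu),
      P.Feasible s' q' x' u' → P.cost s q x u ≤ P.cost s' q' x' u'

/-- The standing assumptions on the data of the problem. -/
structure Assumptions (P : ImplicitProblem d nx nu G) : Prop where
  smooth_c : ∀ t < P.N,
    ContMDiffOn ((𝓡 d).prod ((𝓡 d).prod ((𝓡 nx).prod (𝓡 nu)))) 𝓘(ℝ, ℝ) ∞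
      (fun p : G × G × RSp nx × RSp nu => P.c t p.1 p.2.1 p.2.2.1 p.2.2.2) (P.Oe ×ˢ univ)
  smooth_f : ∀ t < P.N,
    ContMDiffOn ((𝓡 d).prod ((𝓡 d).prod ((𝓡 nx).prod (𝓡 nu)))) (𝓡 nx) ∞
      (fun p : G × G × RSp nx × RSp nu => P.f t p.1 p.2.1 p.2.2.1 p.2.2.2) (P.Oe ×ˢ univ)
  smooth_v : ∀ t < P.N,
    ContMDiffOn ((𝓡 d).prod ((𝓡 d).prod (𝓡 nx))) (𝓡 d) ∞
      (fun p : G × G × RSp nx => P.v t p.1 p.2.1 p.2.2) (P.Oe ×ˢ univ)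
  isOpen_Oe : IsOpen P.Oe
  one_mem_Oe : 1 ∈ P.Oe
  /-- `v_t (·, q_t, x_t)` is a diffeomorphism of `Oe` onto its image along every admissible
  trajectory. -/
  v_diffeo : ∀ (s q : ℕ → G) (x : ℕ → RSp nx) (u : ℕ → RSp nu), P.Feasible s q x u →
    ∀ t < P.N, IsDiffeoOntoImage (𝓡 d) (𝓡 d) (fun g : G => P.v t g (q t) (x t)) P.Oe
  exp_diffeo : IsDiffeoOntoImage (𝓡 d) (𝓡 d) (lieExp : RSp d → G) P.O
  convex_U : ∀ t < P.N, Convex ℝ (P.U t)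

/-- The Hamiltonian
`H^ν (t, ζ, ξ, s, q, x, u) = ν c_t (s, q, x, u) + ⟨ζ, exp⁻¹ s⟩ + ⟨ξ, f_t (s, q, x, u)⟩`. -/
def ham (P : ImplicitProblem d nx nu G) (ν : ℝ) (t : ℕ) (ζ : RSp d →L[ℝ] ℝ)
    (ξ : RSp nx →L[ℝ] ℝ) (s q : G) (x : RSp nx) (u : RSp nu) : ℝ :=
  ν * P.c t s q x u + ζ (lieLog P.O s) + ξ (P.f t s q x u)

/-! Partial derivatives of the Hamiltonian and of `v_t`. -/

section Derivatives

variable (P : ImplicitProblem d nx nu G) (ν : ℝ) (t : ℕ) (ζ : RSp d →L[ℝ] ℝ)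
    (ξ : RSp nx →L[ℝ] ℝ) (s q : G) (x : RSp nx) (u : RSp nu)

/-- `D_ζ H`, an element of the Lie algebra. -/
def hamZeta : RSp d := dualGradient (fun ζ' => P.ham ν t ζ' ξ s q x u) ζ

/-- `D_ξ H`, an element of `ℝ^nx`. -/
def hamXi : RSp nx := dualGradient (fun ξ' => P.ham ν t ζ ξ' s q x u) ξ

/-- `D_s H`, a covector at `s`. -/
def hamS : RSp d →L[ℝ] ℝ := groupDeriv (fun s' => P.ham ν t ζ ξ s' q x u) s

/-- `D_q H`, a covector at `q`. -/
def hamQ : RSp d →L[ℝ] ℝ := groupDeriv (fun q' => P.ham ν t ζ ξ s q' x u) q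

/-- `D_x H`. -/
def hamX : RSp nx →L[ℝ] ℝ := fderiv ℝ (fun x' => P.ham ν t ζ ξ s q x' u) x

/-- `D_u H`. -/
def hamU : RSp nu →L[ℝ] ℝ := fderiv ℝ (fun u' => P.ham ν t ζ ξ s q x u') u

/-- `D_s v_t`, a linear map on `T_s G`. -/
def vS : RSp d →L[ℝ] RSp d := groupDeriv (fun s' => P.v t s' q x) s

/-- `D_q v_t`, a linear map on `T_q G`. -/
def vQ : RSp d →L[ℝ] RSp d := groupDeriv (fun q' => P.v t s q' x) q

/-- `D_x v_t`. -/
def vX : RSp nx →L[ℝ] RSp d := fderiv ℝ (fun x' => P.v t s q x') x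

/-- The covector `ρ = (D(exp⁻¹)(exp (D_ζ H)) ∘ T_e Φ_{exp (D_ζ H)})^* ζ`. -/
def rho : RSp d →L[ℝ] ℝ :=
  ζ.comp (dLog P.O (lieExp (P.hamZeta ν t ζ ξ s q x u) : G))

end Derivatives

end ImplicitProblem

end

/-!
The integration steps, poses, states and controls are treated as independent variables, and the
dynamics as equality constraints: `v_t = 0`, `f_t = x_{t+1}`, and the kinematics in the form
`exp⁻¹ s_t = exp⁻¹ (q_t⁻¹ q_{t+1})`, which is equivalent to `q_{t+1} = q_t s_t` near the optimal
trajectory because `exp⁻¹` is injective on `exp O`. In this form no implicit function theorem is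
needed for the integration step, and the multiplier of the kinematic constraint is the covector
`ζᵗ` of the Hamiltonian.

Right perturbations `q_t κ(y)`, with `κ` a chart at the identity whose derivative is the identity
of the Lie algebra, turn this into a minimization in a finite-dimensional vector space over a
convex set (the controls) under finitely many smooth equality constraints.
`exists_multiplier_of_eventually_min` is the corresponding Fritz John rule: if the cone spanned by
the directions of cost and constraints contains the direction "cost decreases, constraints stay"
in its interior, then the inverse function theorem produces a better feasible point; otherwise a
hyperplane separates the two, and its normal is the multiplier.

Testing the resulting inequality with variations at a single time (`stage_conditions`) decouples
it. The variation of `s_t` gives `μ_t = -D_s H ∘ (D_s v_t)⁻¹` for the multiplier of `v_t = 0`,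
which, substituted into the conditions for `q_t` and `x_t`, yields the adjoint equations. The
variation of `q_t` enters the logarithm through `h⁻¹ s_t = s_t (s_t⁻¹ h⁻¹ s_t)`
(`hasFDerivAt_lieLog_perturbed`), whence `Ad` of `s_t⁻¹ = exp (-exp⁻¹ s_t)`. The last equality is
`lieExp_neg`, a consequence of the uniqueness of one-parameter subgroups as integral curves of
left-invariant vector fields. Finally, if `ν`, `ζ` and `ξ` vanished then so would `μ`, and with it
all multipliers.
-/

noncomputable section

open Filter Topology

/-! ### First-order conditions for minimization on a convex set under equality constraints -/

/-- Separation of a point from the interior of a convex cone in finite dimension; the cone may have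
empty interior, in which case a functional vanishing on it is used. -/
theorem exists_dual_nonpos_of_notMem_interior {Y : Type*} [NormedAddCommGroup Y] [NormedSpace ℝ Y]
    [FiniteDimensional ℝ Y] (T : ConvexCone ℝ Y) (h0 : (0 : Y) ∈ T) {p : Y} (hp0 : p ≠ 0)
    (hp : p ∉ interior (T : Set Y)) :
    ∃ l : Y →L[ℝ] ℝ, l ≠ 0 ∧ (∀ y ∈ T, l y ≤ 0) ∧ 0 ≤ l p := by
  have : Nontrivial Y := ⟨p, 0, hp0⟩
  by_cases hne : (interior (T : Set Y)).Nonempty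
  · obtain ⟨l, hl⟩ := geometric_hahn_banach_open_point T.convex.interior isOpen_interior hp
    have hle : ∀ y ∈ T, l y ≤ l p := by
      intro y hy
      have hy' : y ∈ closure (interior (T : Set Y)) := by
        rw [T.convex.closure_interior_eq_closure_of_nonempty_interior hne]
        exact subset_closure hy
      exact closure_minimal (fun a ha => (hl a ha).le : interior (T : Set Y) ⊆ {a | l a ≤ l p})
        (isClosed_le l.continuous continuous_const) hy'
    refine ⟨l, ?_, ?_, by simpa using hle 0 h0⟩
    · rintro rfl
      obtain ⟨a, ha⟩ := hne
      simpa using hl a ha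
    · intro y hy
      by_contra! hpos
      have h := hle _ (T.smul_mem (c := (|l p| + 1) / l y) (by positivity) hy)
      have h' : l (((|l p| + 1) / l y) • y) = |l p| + 1 := by
        rw [map_smul, smul_eq_mul]; field_simp
      rw [h'] at h
      linarith [le_abs_self (l p)]
  · -- a convex set with empty interior spans a proper subspace
    have hspan : Submodule.span ℝ (T : Set Y) < ⊤ := by
      rw [lt_top_iff_ne_top]
      intro htop
      apply hne
      rw [T.convex.interior_nonempty_iff_affineSpan_eq_top]
      rw [AffineSubspace.affineSpan_eq_top_iff_vectorSpan_eq_top_of_nonempty ℝ Y Y ⟨0, h0⟩,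
        eq_top_iff, ← htop, Submodule.span_le]
      intro y hy
      simpa using vsub_mem_vectorSpan ℝ hy (SetLike.mem_coe.2 h0)
    obtain ⟨f, hf, hfT⟩ := Submodule.exists_le_ker_of_lt_top _ hspan
    have hzero : ∀ y ∈ T, f y = 0 := fun y hy => hfT (Submodule.subset_span hy)
    rcases le_total 0 (f p) with h | h
    · refine ⟨LinearMap.toContinuousLinearMap f, by simpa using hf, ?_, by simpa using h⟩
      intro y hy
      simp [hzero y hy]
    · refine ⟨LinearMap.toContinuousLinearMap (-f), by simpa using hf, ?_, by simpa using h⟩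
      intro y hy
      simp [hzero y hy]

/-- If `p` is interior to the cone generated by the images `G' c` of the directions `c` of a convex
set `C ∋ 0`, then arbitrarily close to `0` there are points of `C` at which `G` has moved exactly in
the direction `p`. -/
theorem exists_mem_convex_of_mem_interior_cone {E Y : Type*} [NormedAddCommGroup E]
    [NormedSpace ℝ E] [NormedAddCommGroup Y] [NormedSpace ℝ Y] [FiniteDimensional ℝ Y]
    {G : E → Y} {G' : E →L[ℝ] Y} (hG : HasStrictFDerivAt G G' 0) {C : Set E} (hC : Convex ℝ C)
    (h0 : (0 : E) ∈ C) {p : Y} (hp0 : p ≠ 0)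
    (hp : p ∈ interior (ConvexCone.hull ℝ (G' '' C) : Set Y))
    {V : Set E} (hV : V ∈ 𝓝 0) :
    ∃ ε > (0 : ℝ), ∃ z ∈ V ∩ C, G z = G 0 + ε • p := by
  -- a simplex with vertices `b i` in the cone around `p`
  obtain ⟨b, hb, hbT⟩ := exists_mem_interior_convexHull_affineBasis
    (mem_interior_iff_mem_nhds.1 hp)
  rw [b.interior_convexHull] at hb
  have hbi : ∀ i, ∃ t > (0 : ℝ), ∃ c ∈ C, t • G' c = b i := by
    intro i
    obtain ⟨t, ht, y, ⟨c, hc, rfl⟩, h⟩ :=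
      (ConvexCone.mem_hull_of_convex (hC.linear_image (G' : E →ₗ[ℝ] Y))).1
        (hbT (subset_convexHull ℝ _ (mem_range_self i)))
    exact ⟨t, ht, c, hc, h⟩
  choose t ht c hc htc using hbi
  let S : (Fin (Module.finrank ℝ Y + 1) → ℝ) →L[ℝ] E :=
    ∑ i, (ContinuousLinearMap.proj i).smulRight (t i • c i)
  have hS : ∀ a, S a = ∑ i, (a i * t i) • c i := by
    intro a; simp [S, mul_smul]
  have hGS : ∀ a, G' (S a) = ∑ i, a i • b i := by
    intro a; simp [hS, mul_smul, htc]
  have hsurj : ∀ y, G' (S fun i => b.coord i y) = y := by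
    intro y; rw [hGS]; exact b.linear_combination_coord_eq_self y
  obtain ⟨R₀, hR₀⟩ := LinearMap.exists_rightInverse_of_surjective
    ((G'.comp S : _ →L[ℝ] Y) : _ →ₗ[ℝ] Y)
    (LinearMap.range_eq_top.2 fun y => ⟨fun i => b.coord i y, hsurj y⟩)
  have hR₀' : ∀ y, G' (S (R₀ y)) = y := fun y => LinearMap.congr_fun hR₀ y
  -- correct the right inverse so that it maps `p` to its barycentric coordinates
  obtain ⟨φ, hφ⟩ := SeparatingDual.exists_eq_one (R := ℝ) hp0
  let α : Fin (Module.finrank ℝ Y + 1) → ℝ := fun i => b.coord i p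
  let R : Y →L[ℝ] (Fin (Module.finrank ℝ Y + 1) → ℝ) :=
    φ.smulRight α + (LinearMap.toContinuousLinearMap R₀).comp
      (ContinuousLinearMap.id ℝ Y - φ.smulRight p)
  have hRp : R p = α := by simp [R, hφ]
  have hR : ∀ y, G' (S (R y)) = y := by
    intro y
    have : R y = φ y • α + R₀ (y - φ y • p) := by simp [R]
    rw [this, map_add, map_add, hR₀', map_smul, map_smul, hsurj p]
    abel
  have hΦ : HasStrictFDerivAt (fun y => G (S (R y)))
      ((ContinuousLinearEquiv.refl ℝ Y : Y ≃L[ℝ] Y) : Y →L[ℝ] Y) 0 := by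
    have h1 : HasStrictFDerivAt (fun y => S (R y)) (S.comp R) 0 := (S.comp R).hasStrictFDerivAt
    have h2 : HasStrictFDerivAt G G' (S (R 0)) := by simpa using hG
    have h3 := h2.comp (0 : Y) h1
    have h4 : G'.comp (S.comp R) = ((ContinuousLinearEquiv.refl ℝ Y : Y ≃L[ℝ] Y) : Y →L[ℝ] Y) := by
      ext y; simp [hR]
    rw [← h4]; exact h3
  -- the curve `ε ↦ R (Ψ (G 0 + ε • p))` of coefficients starts at `0` with velocity `α`, whose
  -- entries are positive, so that it enters the positive orthant
  let Ψ := hΦ.localInverse _ _ _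
  have hΨ0 : Ψ (G 0) = 0 := by
    have := hΦ.localInverse_apply_image
    simpa using this
  have hline : HasDerivAt (fun ε : ℝ => G 0 + ε • p) p 0 := by
    simpa using ((hasDerivAt_id (0 : ℝ)).smul_const p).const_add (G 0)
  have hβ : HasDerivAt (fun ε : ℝ => R (Ψ (G 0 + ε • p))) α 0 := by
    have h1 : HasFDerivAt Ψ (ContinuousLinearMap.id ℝ Y) (G 0 + (0 : ℝ) • p) := by
      have := hΦ.to_localInverse.hasFDerivAt
      simpa using this
    have h2 := h1.comp_hasDerivAt (0 : ℝ) hline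
    have h3 := R.hasFDerivAt.comp_hasDerivAt (0 : ℝ) h2
    rw [ContinuousLinearMap.id_apply, hRp] at h3
    exact h3
  have hβ0 : R (Ψ (G 0 + (0 : ℝ) • p)) = 0 := by simp [hΨ0]
  have hβt : Tendsto (fun ε : ℝ => R (Ψ (G 0 + ε • p))) (𝓝[>] 0) (𝓝 0) := by
    have := hβ.continuousAt.tendsto
    rw [hβ0] at this
    exact this.mono_left nhdsWithin_le_nhds
  have hpos : ∀ᶠ ε : ℝ in 𝓝[>] 0, ∀ i, 0 < R (Ψ (G 0 + ε • p)) i := by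
    rw [eventually_all]
    intro i
    have h1 := (hasDerivAt_pi.1 hβ i).tendsto_slope_zero_right
    have h2 := h1.eventually (lt_mem_nhds (hb i))
    filter_upwards [h2, self_mem_nhdsWithin] with ε hε hε0
    have hε0 : 0 < ε := hε0
    rw [hβ0] at hε
    simp only [zero_add, Pi.zero_apply, sub_zero, smul_eq_mul] at hε
    exact (mul_pos_iff_of_pos_left (inv_pos.2 hε0)).1 hε
  have hle : ∀ᶠ ε : ℝ in 𝓝[>] 0, ∑ i, R (Ψ (G 0 + ε • p)) i * t i ≤ 1 := by
    have h1 : Continuous fun a : Fin (Module.finrank ℝ Y + 1) → ℝ => ∑ i, a i * t i := by fun_prop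
    have h2 := (h1.tendsto 0).comp hβt
    have h3 : ∑ i, (0 : Fin (Module.finrank ℝ Y + 1) → ℝ) i * t i < 1 := by simp
    exact (h2.eventually (gt_mem_nhds h3)).mono fun _ h => h.le
  have hVe : ∀ᶠ ε : ℝ in 𝓝[>] 0, S (R (Ψ (G 0 + ε • p))) ∈ V := by
    have h2 := (S.continuous.tendsto 0).comp hβt
    rw [map_zero] at h2
    exact h2.eventually hV
  have hsol : ∀ᶠ ε : ℝ in 𝓝[>] 0, G (S (R (Ψ (G 0 + ε • p)))) = G 0 + ε • p := by
    have h1 : Tendsto (fun ε : ℝ => G 0 + ε • p) (𝓝[>] 0) (𝓝 (G (S (R 0)))) := by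
      have := hline.continuousAt.tendsto
      simp only [zero_smul, add_zero] at this
      simpa using this.mono_left nhdsWithin_le_nhds
    exact h1.eventually hΦ.eventually_right_inverse
  obtain ⟨ε, h1, h2, h3, h4, hε⟩ :=
    (hpos.and (hle.and (hVe.and (hsol.and self_mem_nhdsWithin)))).exists
  refine ⟨ε, hε, _, ⟨h3, ?_⟩, h4⟩
  set a := R (Ψ (G 0 + ε • p))
  have hw : ∀ i, 0 < a i * t i := fun i => mul_pos (h1 i) (ht i)
  have hW : 0 < ∑ i, a i * t i := Finset.sum_pos (fun i _ => hw i) Finset.univ_nonempty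
  have hcm := hC.centerMass_mem (t := Finset.univ) (w := fun i => a i * t i) (z := c)
    (fun i _ => (hw i).le) hW (fun i _ => hc i)
  have := hC.smul_mem_of_zero_mem h0 hcm ⟨hW.le, h2⟩
  rw [Finset.centerMass, smul_smul, mul_inv_cancel₀ hW.ne', one_smul] at this
  rw [hS]; exact this

/-- **Fritz John conditions** for minimizing `J` on a convex set under the constraint `F z = F 0`,
at a local minimum `0`, with the multiplier of `J` normalized to `-1` or `0`. -/
theorem exists_multiplier_of_eventually_min {E W : Type*} [NormedAddCommGroup E]
    [NormedSpace ℝ E] [NormedAddCommGroup W] [NormedSpace ℝ W] [FiniteDimensional ℝ W]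
    {J : E → ℝ} {F : E → W} {J' : E →L[ℝ] ℝ} {F' : E →L[ℝ] W}
    (hJ : HasStrictFDerivAt J J' 0) (hF : HasStrictFDerivAt F F' 0)
    {C : Set E} (hC : Convex ℝ C) (h0 : (0 : E) ∈ C)
    (hmin : ∀ᶠ z in 𝓝 (0 : E), z ∈ C → F z = F 0 → J 0 ≤ J z) :
    ∃ (ν : ℝ) (μ : W →L[ℝ] ℝ), (ν = -1 ∨ ν = 0) ∧ ¬ (ν = 0 ∧ μ = 0) ∧
      ∀ z ∈ C, ν * J' z + μ (F' z) ≤ 0 := by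
  have hp0 : ((-1 : ℝ), (0 : W)) ≠ 0 := by simp
  have hT0 : (0 : ℝ × W) ∈ ConvexCone.hull ℝ (J'.prod F' '' C) :=
    ConvexCone.subset_hull ⟨0, h0, map_zero _⟩
  have hp : ((-1 : ℝ), (0 : W)) ∉ interior (ConvexCone.hull ℝ (J'.prod F' '' C) : Set (ℝ × W)) := by
    intro hp
    obtain ⟨ε, hε, z, ⟨hzV, hzC⟩, hz⟩ :=
      exists_mem_convex_of_mem_interior_cone (hJ.prodMk hF) hC h0 hp0 hp hmin
    have h1 : J z = J 0 - ε := by simpa [sub_eq_add_neg] using congrArg Prod.fst hz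
    have h2 : F z = F 0 := by simpa using congrArg Prod.snd hz
    have := hzV hzC h2
    linarith
  obtain ⟨l, hl, hlT, hlp⟩ := exists_dual_nonpos_of_notMem_interior _ hT0 hp0 hp
  have hsplit : ∀ a w, l (a, w) = a * l (1, 0) + l.comp (ContinuousLinearMap.inr ℝ ℝ W) w := by
    intro a w
    have : ((a, w) : ℝ × W) = a • ((1 : ℝ), (0 : W)) + (0, w) := by simp
    rw [this, map_add, map_smul]; simp
  have hineq : ∀ z ∈ C, l (1, 0) * J' z + l.comp (ContinuousLinearMap.inr ℝ ℝ W) (F' z) ≤ 0 := by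
    intro z hz
    have := hlT (J' z, F' z) (ConvexCone.subset_hull ⟨z, hz, rfl⟩)
    rw [hsplit] at this
    linarith
  have hν : l (1, 0) ≤ 0 := by
    rw [hsplit, map_zero] at hlp
    linarith
  rcases hν.eq_or_lt with h | h
  · refine ⟨0, l.comp (ContinuousLinearMap.inr ℝ ℝ W), Or.inr rfl, ?_, ?_⟩
    · rintro ⟨-, h2⟩
      apply hl
      refine ContinuousLinearMap.ext fun y => ?_
      rw [hsplit y.1 y.2, h, h2]
      simp
    · simpa [h] using hineq
  · refine ⟨-1, (-l (1, 0))⁻¹ • l.comp (ContinuousLinearMap.inr ℝ ℝ W), Or.inl rfl, by simp, ?_⟩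
    intro z hz
    have h1 : 0 < -l (1, 0) := by linarith
    have h2 := mul_nonpos_of_nonneg_of_nonpos (inv_nonneg.2 h1.le) (hineq z hz)
    have h3 : (-l (1, 0))⁻¹ * (l (1, 0) * J' z) = -1 * J' z := by
      have := h.ne
      field_simp
    rw [mul_add, h3] at h2
    simpa using h2

/-! ### One-parameter subgroups and translations -/

section LieGroup

variable {d : ℕ} {G : Type*} [TopologicalSpace G] [ChartedSpace (RSp d) G] [Group G]
  [LieGroup (𝓡 d) ∞ G]

theorem hasMFDerivAt_mul_left_one (g : G) :
    HasMFDerivAt (𝓡 d) (𝓡 d) (fun h : G => g * h) 1 (tangentLeft g : RSp d →L[ℝ] RSp d) :=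
  ((contMDiff_mul_left (I := 𝓡 d) (n := ∞) (a := g)).mdifferentiable (by simp) 1).hasMFDerivAt

theorem isInvertible_tangentLeft (g : G) :
    (tangentLeft g : RSp d →L[ℝ] RSp d).IsInvertible := by
  have hd : ∀ a h : G, MDifferentiableAt (𝓡 d) (𝓡 d) (fun x => a * x) h := fun a h =>
    (contMDiff_mul_left (I := 𝓡 d) (n := ∞) (a := a)).mdifferentiable (by simp) h
  have h1 : HasMFDerivAt (𝓡 d) (𝓡 d) (fun x : G => g⁻¹ * x) (g * 1) _ :=
    (hd g⁻¹ (g * 1)).hasMFDerivAt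
  have h2 := h1.comp (1 : G) (hasMFDerivAt_mul_left_one (d := d) g)
  have e : (fun x : G => g⁻¹ * x) ∘ (fun x => g * x) = id := by ext x; simp
  rw [e] at h2
  have h3 := hasMFDerivAt_unique h2 (hasMFDerivAt_id (1 : G))
  have hinj : Function.Injective (tangentLeft g : RSp d →L[ℝ] RSp d) := by
    apply Function.LeftInverse.injective (g := (mfderiv (𝓡 d) (𝓡 d) (fun x : G => g⁻¹ * x) (g * 1)))
    intro y
    exact DFunLike.congr_fun h3 y
  exact ⟨(LinearEquiv.ofInjectiveEndo _ hinj).toContinuousLinearEquiv, by ext; rfl⟩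

/-- A one-parameter subgroup, differentiable at time zero, is an integral curve of the left-invariant
vector field generated by its velocity, since `γ (t + a) = γ t * γ a`. -/
theorem IsOneParamSubgroup.isMIntegralCurve {X : RSp d} {γ : ℝ → G}
    (hγ : IsOneParamSubgroup X γ) :
    IsMIntegralCurve (I := 𝓡 d) γ
      (mulInvariantVectorField (I := 𝓡 d) (G := G) (X : GroupLieAlgebra (𝓡 d) G)) := by
  obtain ⟨h0, hadd, hder⟩ := hγ
  intro t
  have e : γ = (fun h => γ t * h) ∘ γ ∘ (fun a => -t + a) := by
    ext a; simp [← hadd]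
  have h1 : HasMFDerivAt 𝓘(ℝ, ℝ) 𝓘(ℝ, ℝ) (fun a : ℝ => -t + a) t (ContinuousLinearMap.id ℝ ℝ) :=
    ((hasFDerivAt_id t).const_add (-t)).hasMFDerivAt
  have h2 : HasMFDerivAt 𝓘(ℝ, ℝ) (𝓡 d) γ (-t + t) (ContinuousLinearMap.toSpanSingleton ℝ X) := by
    rw [neg_add_cancel]; exact hder
  have h3 := h2.comp t h1
  have h4 : HasMFDerivAt (𝓡 d) (𝓡 d) (fun h : G => γ t * h) ((γ ∘ fun a => -t + a) t)
      (tangentLeft (γ t) : RSp d →L[ℝ] RSp d) := by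
    have := hasMFDerivAt_mul_left_one (d := d) (γ t)
    have e' : ((γ ∘ fun a => -t + a) t) = 1 := by simp [h0]
    rw [e']; exact this
  have h5 := h4.comp t h3
  rw [← e] at h5
  refine h5.congr_mfderiv (ContinuousLinearMap.ext fun a : ℝ => ?_)
  change tangentLeft (γ t) (a • X) = a • tangentLeft (γ t) X
  rw [map_smul]

theorem IsOneParamSubgroup.eq [T2Space G] {X : RSp d} {γ γ' : ℝ → G}
    (hγ : IsOneParamSubgroup X γ) (hγ' : IsOneParamSubgroup X γ') : γ = γ' := by
  have : LieGroup (𝓡 d) (minSmoothness ℝ 3) G := by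
    rw [minSmoothness_of_isRCLikeNormedField]
    exact LieGroup.of_le (n := ∞) (WithTop.coe_le_coe.2 (le_top : (3 : ℕ∞) ≤ ⊤))
  have : IsManifold (𝓡 d) 1 G := IsManifold.of_le (n := ∞) (by exact_mod_cast le_top)
  have hv := contMDiff_mulInvariantVectorField (I := 𝓡 d) (G := G)
    (X : GroupLieAlgebra (𝓡 d) G)
  refine isMIntegralCurve_Ioo_eq_of_contMDiff_boundaryless (I := 𝓡 d) (t₀ := 0) (hv.of_le ?_)
    hγ.isMIntegralCurve hγ'.isMIntegralCurve (by rw [hγ.1, hγ'.1])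
  rw [minSmoothness_of_isRCLikeNormedField]; norm_num

theorem IsOneParamSubgroup.lieExp_eq [T2Space G] {X : RSp d} {γ : ℝ → G}
    (hγ : IsOneParamSubgroup X γ) : lieExp X = γ 1 := by
  have h : ∃ γ : ℝ → G, IsOneParamSubgroup X γ := ⟨γ, hγ⟩
  rw [lieExp, dif_pos h, h.choose_spec.eq hγ]

omit [LieGroup (𝓡 d) ∞ G] in
theorem IsOneParamSubgroup.neg {X : RSp d} {γ : ℝ → G} (hγ : IsOneParamSubgroup X γ) :
    IsOneParamSubgroup (-X) (fun a => γ (-a)) := by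
  obtain ⟨h0, hadd, hder⟩ := hγ
  refine ⟨by simpa using h0, fun a b => by simp only [neg_add, hadd], ?_⟩
  have h1 : HasMFDerivAt 𝓘(ℝ, ℝ) 𝓘(ℝ, ℝ) (fun a : ℝ => -a) 0 (-ContinuousLinearMap.id ℝ ℝ) :=
    (hasFDerivAt_id (0 : ℝ)).neg.hasMFDerivAt
  have h2 : HasMFDerivAt 𝓘(ℝ, ℝ) (𝓡 d) γ (-0) (ContinuousLinearMap.toSpanSingleton ℝ X) := by
    rw [neg_zero]; exact hder
  have h3 := h2.comp (0 : ℝ) h1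
  refine h3.congr_mfderiv (ContinuousLinearMap.ext fun a : ℝ => ?_)
  change (-a) • X = a • -X
  simp

/-- Also true if no one-parameter subgroup with velocity `X` exists: then there is none for `-X`
either, and both sides take the default value `1`. -/
theorem lieExp_neg [T2Space G] (X : RSp d) : (lieExp (-X) : G) = (lieExp X)⁻¹ := by
  by_cases h : ∃ γ : ℝ → G, IsOneParamSubgroup X γ
  · obtain ⟨γ, hγ⟩ := h
    rw [hγ.lieExp_eq, hγ.neg.lieExp_eq, eq_inv_iff_mul_eq_one, ← hγ.2.1]
    simpa using hγ.1
  · have h' : ¬ ∃ γ : ℝ → G, IsOneParamSubgroup (-X) γ := by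
      rintro ⟨γ, hγ⟩
      exact h ⟨_, by simpa using hγ.neg⟩
    rw [lieExp, lieExp, dif_neg h, dif_neg h', inv_one]

variable (d G) in
/-- A smooth local parametrization of `G` near the identity whose derivative at `0` is the
identity of the Lie algebra. -/
theorem exists_param_near_one : ∃ κ : RSp d → G, κ 0 = 1 ∧ ContMDiffAt (𝓡 d) (𝓡 d) ∞ κ 0 ∧
    HasMFDerivAt (𝓡 d) (𝓡 d) κ 0 (ContinuousLinearMap.id ℝ (RSp d)) := by
  have : IsManifold (𝓡 d) 1 G := IsManifold.of_le (n := ∞) (by exact_mod_cast le_top)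
  let φ := extChartAt (𝓡 d) (1 : G)
  have hr : range (𝓡 d : RSp d → RSp d) = univ := by simp
  have hs : ContMDiffAt (𝓡 d) (𝓡 d) ∞ φ.symm (φ 1 + 0) := by
    rw [add_zero]
    exact (contMDiffOn_extChartAt_symm (1 : G)).contMDiffAt (extChartAt_target_mem_nhds (1 : G))
  have ht : ContMDiff (𝓡 d) (𝓡 d) ∞ (fun y : RSp d => φ 1 + y) :=
    (contDiff_const.add contDiff_id).contMDiff
  have hs' : HasMFDerivAt (𝓡 d) (𝓡 d) φ.symm (φ 1 + 0) (ContinuousLinearMap.id ℝ (RSp d)) := by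
    have h1 := (hs.mdifferentiableAt (by simp)).hasMFDerivAt
    have h2 := mfderivWithin_range_extChartAt_symm (I := 𝓡 d) (x := (1 : G))
    rw [hr, mfderivWithin_univ] at h2
    rw [add_zero] at h1 ⊢
    rw [h2] at h1
    exact h1
  have ht' : HasMFDerivAt (𝓡 d) (𝓡 d) (fun y : RSp d => φ 1 + y) 0
      (ContinuousLinearMap.id ℝ (RSp d)) :=
    ((hasFDerivAt_id (0 : RSp d)).const_add (φ 1)).hasMFDerivAt
  refine ⟨φ.symm ∘ fun y => φ 1 + y, ?_, hs.comp (0 : RSp d) (ht 0), ?_⟩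
  · simp [φ]
  · have := hs'.comp (0 : RSp d) ht'
    exact this

/-- The derivative of the inversion at the identity, from differentiating `h * h⁻¹ = 1`. -/
theorem hasMFDerivAt_inv_one :
    HasMFDerivAt (𝓡 d) (𝓡 d) (fun h : G => h⁻¹) 1 (-ContinuousLinearMap.id ℝ (RSp d)) := by
  have hi := (((contMDiff_inv (𝓡 d) ∞ : ContMDiff (𝓡 d) (𝓡 d) ∞ fun h : G => h⁻¹)
    1).mdifferentiableAt (by simp)).hasMFDerivAt
  have hm := (((contMDiff_mul (𝓡 d) ∞ : ContMDiff _ (𝓡 d) ∞ fun p : G × G => p.1 * p.2)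
    (1, (1 : G)⁻¹)).mdifferentiableAt (by simp))
  have h1 := hm.hasMFDerivAt.comp (1 : G) ((hasMFDerivAt_id (1 : G)).prodMk hi)
  have e : ((fun p : G × G => p.1 * p.2) ∘ fun y : G => (id y, y⁻¹)) = fun _ => 1 := by
    ext y; simp
  rw [e] at h1
  have h2 := hasMFDerivAt_unique h1 (hasMFDerivAt_const (1 : G) (1 : G))
  refine hi.congr_mfderiv (ContinuousLinearMap.ext fun y : RSp d => ?_)
  have h5 : (fun z : G => z * (1 : G)⁻¹) = id := by ext; simp
  have h6 : (fun z : G => (1 : G) * z) = id := by ext; simp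
  have D1 : mfderiv (𝓡 d) (𝓡 d) (fun z : G => z * (1 : G)⁻¹) 1 =
      ContinuousLinearMap.id ℝ (RSp d) := by rw [h5]; exact mfderiv_id
  have D2 : mfderiv (𝓡 d) (𝓡 d) (fun z : G => (1 : G) * z) (1 : G)⁻¹ =
      ContinuousLinearMap.id ℝ (RSp d) := by rw [h6]; exact mfderiv_id
  let A : RSp d →L[ℝ] RSp d := mfderiv (𝓡 d) (𝓡 d) (fun h : G => h⁻¹) 1
  have h7 : y + A y = 0 :=
    (congrArg₂ (fun a b : RSp d => a + b) (DFunLike.congr_fun D1 y).symm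
      (DFunLike.congr_fun D2 (A y)).symm).trans
      ((mfderiv_prod_eq_add_apply hm (v := (y, A y))).symm.trans (DFunLike.congr_fun h2 y))
  exact eq_neg_of_add_eq_zero_right h7

end LieGroup

/-! ### Derivatives of functions on a Lie group -/

section LieGroup

variable {d : ℕ} {G : Type*} [TopologicalSpace G] [ChartedSpace (RSp d) G] [Group G]

omit [Group G] in
theorem IsDiffeoOntoImage.isInvertible_groupDeriv {f : G → RSp d} {O : Set G}
    (h : IsDiffeoOntoImage (𝓡 d) (𝓡 d) f O) {g : G} (hg : g ∈ O) :
    (groupDeriv f g : RSp d →L[ℝ] RSp d).IsInvertible := by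
  obtain ⟨hO, hfO, hf, k, hk, hks⟩ := h
  have h1 := (hf.contMDiffAt (hO.mem_nhds hg)).mdifferentiableAt (by simp)
  have h2 := (hks.contMDiffAt (hfO.mem_nhds (mem_image_of_mem f hg))).mdifferentiableAt (by simp)
  have h3 := h2.hasMFDerivAt.comp g h1.hasMFDerivAt
  have h4 : HasMFDerivAt (𝓡 d) (𝓡 d) (k ∘ f) g (ContinuousLinearMap.id ℝ (RSp d)) :=
    (hasMFDerivAt_id g).congr_of_eventuallyEq (by
      filter_upwards [hO.mem_nhds hg] with y hy using hk hy)
  have h5 := hasMFDerivAt_unique h3 h4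
  have hinj : Function.Injective (groupDeriv f g : RSp d →L[ℝ] RSp d) := by
    apply Function.LeftInverse.injective (g := mfderiv (𝓡 d) (𝓡 d) k (f g))
    intro y
    exact DFunLike.congr_fun h5 y
  exact ⟨(LinearEquiv.ofInjectiveEndo _ hinj).toContinuousLinearEquiv, by ext; rfl⟩

theorem lieExp_lieLog {O : Set (RSp d)} {g : G} (hg : g ∈ (lieExp : RSp d → G) '' O) :
    lieExp (lieLog O g) = g := Function.invFunOn_eq hg

theorem lieLog_injOn (O : Set (RSp d)) :
    InjOn (lieLog O) ((lieExp : RSp d → G) '' O) := fun a ha b hb h => by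
  rw [← lieExp_lieLog ha, h, lieExp_lieLog hb]

theorem IsDiffeoOntoImage.contMDiffAt_lieLog {O : Set (RSp d)}
    (h : IsDiffeoOntoImage (𝓡 d) (𝓡 d) (lieExp : RSp d → G) O) {g : G}
    (hg : g ∈ (lieExp : RSp d → G) '' O) : ContMDiffAt (𝓡 d) (𝓡 d) ∞ (lieLog O) g := by
  obtain ⟨hO, hfO, hf, k, hk, hks⟩ := h
  have h1 := hks.contMDiffAt (hfO.mem_nhds hg)
  refine h1.congr_of_eventuallyEq ?_
  filter_upwards [hfO.mem_nhds hg] with y hy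
  -- both `lieLog O y` and `k y` are the only preimage of `y` in `O`
  have h2 : lieLog O y ∈ O := Function.invFunOn_mem hy
  rw [← hk h2, lieExp_lieLog hy]

omit [Group G] in
/-- If `a` and `b` are curves (or families) in `G` through `s` and `q`, the derivative of
`F (a, b, x, u)` is the sum of the four partial derivatives. -/
theorem hasFDerivAt_comp_of_partials {E X U M : Type*} [NormedAddCommGroup E] [NormedSpace ℝ E]
    [NormedAddCommGroup X] [NormedSpace ℝ X] [NormedAddCommGroup U] [NormedSpace ℝ U]
    [NormedAddCommGroup M] [NormedSpace ℝ M]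
    {F : G → G → X → U → M} {a b : E → G} {x : E → X} {u : E → U} {z : E}
    {a' b' : E →L[ℝ] RSp d} {x' : E →L[ℝ] X} {u' : E →L[ℝ] U}
    (hF : MDifferentiableAt ((𝓡 d).prod ((𝓡 d).prod (𝓘(ℝ, X).prod 𝓘(ℝ, U)))) 𝓘(ℝ, M)
      (fun p : G × G × X × U => F p.1 p.2.1 p.2.2.1 p.2.2.2) (a z, b z, x z, u z))
    (ha : HasMFDerivAt 𝓘(ℝ, E) (𝓡 d) a z a') (hb : HasMFDerivAt 𝓘(ℝ, E) (𝓡 d) b z b')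
    (hx : HasFDerivAt x x' z) (hu : HasFDerivAt u u' z) :
    HasFDerivAt (fun w => F (a w) (b w) (x w) (u w))
      ((groupDeriv (fun s => F s (b z) (x z) (u z)) (a z)).comp a' +
        (groupDeriv (fun q => F (a z) q (x z) (u z)) (b z)).comp b' +
        (fderiv ℝ (fun y => F (a z) (b z) y (u z)) (x z)).comp x' +
        (fderiv ℝ (fun y => F (a z) (b z) (x z) y) (u z)).comp u') z := by
  set L : (RSp d × RSp d × X × U) →L[ℝ] M :=
    mfderiv ((𝓡 d).prod ((𝓡 d).prod (𝓘(ℝ, X).prod 𝓘(ℝ, U)))) 𝓘(ℝ, M)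
      (fun p : G × G × X × U => F p.1 p.2.1 p.2.2.1 p.2.2.2) (a z, b z, x z, u z) with hL
  have hF' := hF.hasMFDerivAt
  have hc := hF'.comp z (ha.prodMk (hb.prodMk (hx.hasMFDerivAt.prodMk hu.hasMFDerivAt)))
  have h1 := hF'.comp (a z) ((hasMFDerivAt_id (I := 𝓡 d) (a z)).prodMk
    ((hasMFDerivAt_const (I := 𝓡 d) (I' := 𝓡 d) (b z) (a z)).prodMk
      ((hasMFDerivAt_const (I := 𝓡 d) (I' := 𝓘(ℝ, X)) (x z) (a z)).prodMk
        (hasMFDerivAt_const (I := 𝓡 d) (I' := 𝓘(ℝ, U)) (u z) (a z)))))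
  have h2 := hF'.comp (b z) ((hasMFDerivAt_const (I := 𝓡 d) (I' := 𝓡 d) (a z) (b z)).prodMk
    ((hasMFDerivAt_id (I := 𝓡 d) (b z)).prodMk
      ((hasMFDerivAt_const (I := 𝓡 d) (I' := 𝓘(ℝ, X)) (x z) (b z)).prodMk
        (hasMFDerivAt_const (I := 𝓡 d) (I' := 𝓘(ℝ, U)) (u z) (b z)))))
  have h3 := hF'.comp (x z) ((hasMFDerivAt_const (I := 𝓘(ℝ, X)) (I' := 𝓡 d) (a z) (x z)).prodMk
    ((hasMFDerivAt_const (I := 𝓘(ℝ, X)) (I' := 𝓡 d) (b z) (x z)).prodMk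
      ((hasMFDerivAt_id (I := 𝓘(ℝ, X)) (x z)).prodMk
        (hasMFDerivAt_const (I := 𝓘(ℝ, X)) (I' := 𝓘(ℝ, U)) (u z) (x z)))))
  have h4 := hF'.comp (u z) ((hasMFDerivAt_const (I := 𝓘(ℝ, U)) (I' := 𝓡 d) (a z) (u z)).prodMk
    ((hasMFDerivAt_const (I := 𝓘(ℝ, U)) (I' := 𝓡 d) (b z) (u z)).prodMk
      ((hasMFDerivAt_const (I := 𝓘(ℝ, U)) (I' := 𝓘(ℝ, X)) (x z) (u z)).prodMk
        (hasMFDerivAt_id (I := 𝓘(ℝ, U)) (u z)))))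
  have e1 : ∀ y : RSp d, groupDeriv (fun s => F s (b z) (x z) (u z)) (a z) y = L (y, 0, 0, 0) :=
    fun y => DFunLike.congr_fun h1.mfderiv y
  have e2 : ∀ y : RSp d, groupDeriv (fun q => F (a z) q (x z) (u z)) (b z) y = L (0, y, 0, 0) :=
    fun y => DFunLike.congr_fun h2.mfderiv y
  have e3 : ∀ y : X, fderiv ℝ (fun y => F (a z) (b z) y (u z)) (x z) y = L (0, 0, y, 0) :=
    fun y => congrArg (fun T : X →L[ℝ] M => T y) (HasFDerivAt.fderiv (𝕜 := ℝ) (E := X) (F := M)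
      (f' := L.comp ((0 : X →L[ℝ] RSp d).prod ((0 : X →L[ℝ] RSp d).prod
        ((ContinuousLinearMap.id ℝ X).prod (0 : X →L[ℝ] U))))) h3.hasFDerivAt)
  have e4 : ∀ y : U, fderiv ℝ (fun y => F (a z) (b z) (x z) y) (u z) y = L (0, 0, 0, y) :=
    fun y => congrArg (fun T : U →L[ℝ] M => T y) (HasFDerivAt.fderiv (𝕜 := ℝ) (E := U) (F := M)
      (f' := L.comp ((0 : U →L[ℝ] RSp d).prod ((0 : U →L[ℝ] RSp d).prod
        ((0 : U →L[ℝ] X).prod (ContinuousLinearMap.id ℝ U))))) h4.hasFDerivAt)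
  refine HasFDerivAt.congr_fderiv (hc.hasFDerivAt :) (ContinuousLinearMap.ext fun w : E => ?_)
  change L (a' w, b' w, x' w, u' w) =
    groupDeriv (fun s => F s (b z) (x z) (u z)) (a z) (a' w) +
      groupDeriv (fun q => F (a z) q (x z) (u z)) (b z) (b' w) +
      fderiv ℝ (fun y => F (a z) (b z) y (u z)) (x z) (x' w) +
      fderiv ℝ (fun y => F (a z) (b z) (x z) y) (u z) (u' w)
  rw [e1, e2, e3, e4, ← map_add, ← map_add, ← map_add]
  simp

variable [LieGroup (𝓡 d) ∞ G]

/-- Derivative of `F (h⁻¹ s)` at `h = 1`, computed from `h⁻¹ s = s (s⁻¹ h⁻¹ s)`. -/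
theorem hasMFDerivAt_comp_inv_mul {M : Type*} [NormedAddCommGroup M] [NormedSpace ℝ M] {F : G → M}
    {s : G} (hF : MDifferentiableAt (𝓡 d) 𝓘(ℝ, M) F s) :
    HasMFDerivAt (𝓡 d) 𝓘(ℝ, M) (fun h : G => F (h⁻¹ * s)) 1
      (-((groupDeriv F s).comp ((tangentLeft s).comp (lieAd s⁻¹)))) := by
  have h1 : HasMFDerivAt (𝓡 d) (𝓡 d) (fun h : G => s⁻¹ * h * s⁻¹⁻¹) 1⁻¹
      (lieAd s⁻¹ : RSp d →L[ℝ] RSp d) := by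
    rw [inv_one]
    exact (((contMDiff_const.mul contMDiff_id).mul contMDiff_const : ContMDiff (𝓡 d) (𝓡 d) ∞
      (fun h : G => s⁻¹ * h * s⁻¹⁻¹)).mdifferentiable (by simp) 1).hasMFDerivAt
  have h2 := h1.comp (1 : G) hasMFDerivAt_inv_one
  have h3 : HasMFDerivAt (𝓡 d) (𝓡 d) (fun h : G => s * h)
      (((fun h : G => s⁻¹ * h * s⁻¹⁻¹) ∘ fun h => h⁻¹) 1) (tangentLeft s : RSp d →L[ℝ] RSp d) := by
    have e : ((fun h : G => s⁻¹ * h * s⁻¹⁻¹) ∘ fun h => h⁻¹) 1 = 1 := by simp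
    rw [e]; exact hasMFDerivAt_mul_left_one s
  have h4 := h3.comp (1 : G) h2
  have h5 : HasMFDerivAt (𝓡 d) 𝓘(ℝ, M) F (((fun h : G => s * h) ∘
      ((fun h : G => s⁻¹ * h * s⁻¹⁻¹) ∘ fun h => h⁻¹)) 1) (groupDeriv F s : RSp d →L[ℝ] M) := by
    have e : ((fun h : G => s * h) ∘ ((fun h : G => s⁻¹ * h * s⁻¹⁻¹) ∘ fun h => h⁻¹)) 1 = s := by
      simp
    rw [e]; exact hF.hasMFDerivAt
  have h6 := h5.comp (1 : G) h4
  have e : F ∘ ((fun h : G => s * h) ∘ ((fun h : G => s⁻¹ * h * s⁻¹⁻¹) ∘ fun h => h⁻¹)) =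
      fun h : G => F (h⁻¹ * s) := by
    ext h; simp [mul_assoc]
  rw [e] at h6
  refine h6.congr_mfderiv (ContinuousLinearMap.ext fun y : RSp d => ?_)
  change groupDeriv F s (tangentLeft s (lieAd s⁻¹ (-y))) =
    -(groupDeriv F s (tangentLeft s (lieAd s⁻¹ y)))
  simp only [map_neg]

end LieGroup

/-! ### Right perturbations in a Lie group -/

section Perturbation

variable {d : ℕ} {G : Type*} [TopologicalSpace G] [ChartedSpace (RSp d) G] [Group G]
  [LieGroup (𝓡 d) ∞ G] {κ : RSp d → G} (h1 : κ 0 = 1)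
  {E X U M : Type*} [NormedAddCommGroup E] [NormedSpace ℝ E]
  [NormedAddCommGroup X] [NormedSpace ℝ X] [NormedAddCommGroup U] [NormedSpace ℝ U]
  [NormedAddCommGroup M] [NormedSpace ℝ M]

include h1

omit h1 in
theorem contMDiffAt_mul_param (hκ : ContMDiffAt (𝓡 d) (𝓡 d) ∞ κ 0) (g : G) (A : E →L[ℝ] RSp d) :
    ContMDiffAt 𝓘(ℝ, E) (𝓡 d) ∞ (fun w => g * κ (A w)) 0 := by
  have h2 : ContMDiffAt (𝓡 d) (𝓡 d) ∞ κ (A 0) := by rw [map_zero]; exact hκ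
  exact contMDiffAt_const.mul (h2.comp (0 : E) A.contMDiff.contMDiffAt)

theorem hasMFDerivAt_mul_param
    (hκ : HasMFDerivAt (𝓡 d) (𝓡 d) κ 0 (ContinuousLinearMap.id ℝ (RSp d))) (g : G)
    (A : E →L[ℝ] RSp d) :
    HasMFDerivAt 𝓘(ℝ, E) (𝓡 d) (fun w => g * κ (A w)) 0 ((tangentLeft g).comp A) := by
  have h2 : HasMFDerivAt (𝓡 d) (𝓡 d) κ (A 0) (ContinuousLinearMap.id ℝ (RSp d)) := by
    rw [map_zero]; exact hκ
  have h3 := h2.comp (0 : E) A.hasFDerivAt.hasMFDerivAt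
  have h4 : HasMFDerivAt (𝓡 d) (𝓡 d) (fun h : G => g * h) ((κ ∘ A) 0)
      (tangentLeft g : RSp d →L[ℝ] RSp d) := by
    have e : (κ ∘ A) 0 = 1 := by simp [h1]
    rw [e]; exact hasMFDerivAt_mul_left_one g
  exact h4.comp (0 : E) h3

theorem contDiffAt_perturbed {F : G → G → X → U → M} {s q : G} {x : X} {u : U}
    (hF : ContMDiffAt ((𝓡 d).prod ((𝓡 d).prod (𝓘(ℝ, X).prod 𝓘(ℝ, U)))) 𝓘(ℝ, M) ∞
      (fun p : G × G × X × U => F p.1 p.2.1 p.2.2.1 p.2.2.2) (s, q, x, u))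
    (hκ : ContMDiffAt (𝓡 d) (𝓡 d) ∞ κ 0)
    (S Y : E →L[ℝ] RSp d) (A : E →L[ℝ] X) (B : E →L[ℝ] U) :
    ContDiffAt ℝ ∞ (fun w => F (s * κ (S w)) (q * κ (Y w)) (x + A w) (u + B w)) 0 := by
  have hA : ContMDiffAt 𝓘(ℝ, E) 𝓘(ℝ, X) ∞ (fun w => x + A w) 0 :=
    (contDiff_const.add A.contDiff).contMDiff.contMDiffAt
  have hB : ContMDiffAt 𝓘(ℝ, E) 𝓘(ℝ, U) ∞ (fun w => u + B w) 0 :=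
    (contDiff_const.add B.contDiff).contMDiff.contMDiffAt
  have hc := (contMDiffAt_mul_param hκ s S).prodMk
    ((contMDiffAt_mul_param hκ q Y).prodMk (hA.prodMk hB))
  exact (ContMDiffAt.comp_of_eq (x := (0 : E)) hF hc (by simp [h1])).contDiffAt

theorem hasFDerivAt_perturbed {F : G → G → X → U → M} {s q : G} {x : X} {u : U}
    (hF : ContMDiffAt ((𝓡 d).prod ((𝓡 d).prod (𝓘(ℝ, X).prod 𝓘(ℝ, U)))) 𝓘(ℝ, M) ∞
      (fun p : G × G × X × U => F p.1 p.2.1 p.2.2.1 p.2.2.2) (s, q, x, u))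
    (hκ : HasMFDerivAt (𝓡 d) (𝓡 d) κ 0 (ContinuousLinearMap.id ℝ (RSp d)))
    (S Y : E →L[ℝ] RSp d) (A : E →L[ℝ] X) (B : E →L[ℝ] U) :
    HasFDerivAt (fun w => F (s * κ (S w)) (q * κ (Y w)) (x + A w) (u + B w))
      ((groupDeriv (fun s' => F s' q x u) s).comp ((tangentLeft s).comp S) +
        (groupDeriv (fun q' => F s q' x u) q).comp ((tangentLeft q).comp Y) +
        (fderiv ℝ (fun x' => F s q x' u) x).comp A +
        (fderiv ℝ (fun u' => F s q x u') u).comp B) 0 := by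
  have e1 : s * κ (S 0) = s := by simp [h1]
  have e2 : q * κ (Y 0) = q := by simp [h1]
  have e3 : x + A 0 = x := by simp
  have e4 : u + B 0 = u := by simp
  have h := hasFDerivAt_comp_of_partials (F := F) (z := (0 : E))
    (a := fun w => s * κ (S w)) (b := fun w => q * κ (Y w)) (x := fun w => x + A w)
    (u := fun w => u + B w) (by
      simp only [e1, e2, e3, e4]; exact hF.mdifferentiableAt (by simp))
    (hasMFDerivAt_mul_param h1 hκ s S) (hasMFDerivAt_mul_param h1 hκ q Y)
    (A.hasFDerivAt.const_add x) (B.hasFDerivAt.const_add u)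
  simp only [e1, e2, e3, e4] at h
  exact h

theorem contDiffAt_lieLog_perturbed {O : Set (RSp d)} {s q q' : G} (hq : q' = q * s)
    (hs : ContMDiffAt (𝓡 d) (𝓡 d) ∞ (lieLog O) s)
    (hκ : ContMDiffAt (𝓡 d) (𝓡 d) ∞ κ 0) (Y Y' : E →L[ℝ] RSp d) :
    ContDiffAt ℝ ∞ (fun w => lieLog O ((q * κ (Y w))⁻¹ * (q' * κ (Y' w)))) 0 := by
  have hc := (contMDiffAt_mul_param hκ q Y).inv.mul (contMDiffAt_mul_param hκ q' Y')
  exact (ContMDiffAt.comp_of_eq (x := (0 : E)) hs hc (by simp [h1, hq])).contDiffAt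

/-- Variation of the relative pose `q⁻¹ q'` in logarithmic coordinates. Moving the left end point
`q` along `q h` replaces `s = q⁻¹ q'` by `h⁻¹ s = s (s⁻¹ h⁻¹ s)`, whence the adjoint action. -/
theorem hasFDerivAt_lieLog_perturbed {O : Set (RSp d)} {s q q' : G} (hq : q' = q * s)
    (hs : ContMDiffAt (𝓡 d) (𝓡 d) ∞ (lieLog O) s)
    (hκ : HasMFDerivAt (𝓡 d) (𝓡 d) κ 0 (ContinuousLinearMap.id ℝ (RSp d)))
    (Y Y' : E →L[ℝ] RSp d) :
    HasFDerivAt (fun w => lieLog O ((q * κ (Y w))⁻¹ * (q' * κ (Y' w))))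
      (-((dLog O s).comp ((lieAd s⁻¹).comp Y)) + (dLog O s).comp Y') 0 := by
  have hd := hs.mdifferentiableAt (by simp)
  let F : G → G → ℝ → ℝ → RSp d := fun h k _ _ => lieLog O (h⁻¹ * (s * k))
  have hF : ContMDiffAt ((𝓡 d).prod ((𝓡 d).prod (𝓘(ℝ, ℝ).prod 𝓘(ℝ, ℝ)))) (𝓡 d) ∞
      (fun p : G × G × ℝ × ℝ => F p.1 p.2.1 p.2.2.1 p.2.2.2) (1, 1, 0, 0) := by
    have hc : ContMDiffAt ((𝓡 d).prod ((𝓡 d).prod (𝓘(ℝ, ℝ).prod 𝓘(ℝ, ℝ)))) (𝓡 d) ∞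
        (fun p : G × G × ℝ × ℝ => p.1⁻¹ * (s * p.2.1)) (1, 1, 0, 0) :=
      contMDiffAt_fst.inv.mul (contMDiffAt_const.mul contMDiffAt_snd.fst)
    exact ContMDiffAt.comp_of_eq (x := ((1, 1, 0, 0) : G × G × ℝ × ℝ)) hs hc (by simp)
  have h := hasFDerivAt_perturbed h1 hF hκ Y Y' 0 0
  have e1 : groupDeriv (fun h => F h 1 0 0) 1 = -((dLog O s).comp (lieAd s⁻¹)) := by
    have := (hasMFDerivAt_comp_inv_mul hd).mfderiv
    simp only [F, mul_one]
    exact this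
  have e2 : groupDeriv (fun k => F 1 k 0 0) 1 = dLog O s := by
    have h2 : HasMFDerivAt (𝓡 d) (𝓡 d) (lieLog O) (s * 1)
        (groupDeriv (lieLog O) s : RSp d →L[ℝ] RSp d) := by
      rw [mul_one]; exact hd.hasMFDerivAt
    have h3 := (h2.comp (1 : G) (hasMFDerivAt_mul_left_one s)).mfderiv
    simp only [F, inv_one, one_mul]
    exact h3
  have e3 : (tangentLeft (1 : G) : RSp d →L[ℝ] RSp d) = ContinuousLinearMap.id ℝ (RSp d) := by
    have : (fun h : G => 1 * h) = id := by ext; simp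
    rw [tangentLeft, this]; exact mfderiv_id
  rw [e1, e2, e3] at h
  have e : (fun w => lieLog O ((q * κ (Y w))⁻¹ * (q' * κ (Y' w)))) = fun w =>
      F (1 * κ (Y w)) (1 * κ (Y' w)) (0 + (0 : E →L[ℝ] ℝ) w) (0 + (0 : E →L[ℝ] ℝ) w) := by
    funext w
    simp [F, hq, mul_assoc]
  rw [e]
  refine h.congr_fderiv (ContinuousLinearMap.ext fun w => ?_)
  simp

end Perturbation

/-- The gradient of an affine function on the dual space. -/
theorem dualGradient_eq {n : ℕ} {F : (RSp n →L[ℝ] ℝ) → ℝ} {a : ℝ} {y : RSp n}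
    (hF : ∀ p, F p = a + p y) (p : RSp n →L[ℝ] ℝ) : dualGradient F p = y := by
  have h : HasFDerivAt F (NormedSpace.inclusionInDoubleDual ℝ (RSp n) y) p := by
    have : F = fun p => a + NormedSpace.inclusionInDoubleDual ℝ (RSp n) y p := by
      ext p; rw [hF]; rfl
    rw [this]
    exact (NormedSpace.inclusionInDoubleDual ℝ (RSp n) y).hasFDerivAt.const_add a
  rw [dualGradient, h.fderiv]
  exact Function.leftInverse_invFun
    (NormedSpace.inclusionInDoubleDualLi ℝ (E := RSp n)).injective y

theorem eq_zero_of_apply_nonpos {V : Type*} [NormedAddCommGroup V] [NormedSpace ℝ V]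
    {f : V →L[ℝ] ℝ} (hf : ∀ v, f v ≤ 0) : f = 0 := by
  refine ContinuousLinearMap.ext fun v => le_antisymm (hf v) ?_
  simpa using hf (-v)

theorem sum_apply_single_shift {N : ℕ} {V : Type*} [NormedAddCommGroup V] [NormedSpace ℝ V]
    (g g' : ℕ → V →L[ℝ] ℝ) (v : V) {τ : ℕ} (h1 : 1 ≤ τ) (hτ : τ < N) :
    ∑ t ∈ Finset.range N, (g t ((Pi.single τ v : ℕ → V) t) +
      g' t ((Pi.single τ v : ℕ → V) (t + 1))) = (g τ + g' (τ - 1)) v := by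
  rw [Finset.sum_add_distrib, Finset.sum_eq_single τ, Finset.sum_eq_single (τ - 1)]
  · simp [Nat.sub_add_cancel h1]
  · intro t _ ht
    rw [Pi.single_eq_of_ne (by omega), map_zero]
  · intro h; simp at h; omega
  · intro t _ ht
    rw [Pi.single_eq_of_ne ht, map_zero]
  · intro h; simp at h; omega

/-- Stagewise optimality conditions from the first-order condition for the sum over all stages:
testing with variations concentrated at one time decouples the sum, where the variation of a state
at time `t` enters the stages `t` and `t - 1`. -/
theorem stage_conditions {N : ℕ} {A Q X U : Type*} [NormedAddCommGroup A] [NormedSpace ℝ A]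
    [NormedAddCommGroup Q] [NormedSpace ℝ Q] [NormedAddCommGroup X] [NormedSpace ℝ X]
    [NormedAddCommGroup U] [NormedSpace ℝ U]
    (a : ℕ → A →L[ℝ] ℝ) (b b' : ℕ → Q →L[ℝ] ℝ) (c c' : ℕ → X →L[ℝ] ℝ) (e : ℕ → U →L[ℝ] ℝ)
    {C : ℕ → Set U} (hC : ∀ t < N, 0 ∈ C t)
    (h : ∀ (σ : ℕ → A) (y : ℕ → Q) (χ : ℕ → X) (η : ℕ → U), y 0 = 0 → y N = 0 → χ 0 = 0 →
      χ N = 0 → (∀ t < N, η t ∈ C t) →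
      ∑ t ∈ Finset.range N, (a t (σ t) + (b t (y t) + b' t (y (t + 1))) +
        (c t (χ t) + c' t (χ (t + 1))) + e t (η t)) ≤ 0) :
    (∀ t < N, a t = 0) ∧ (∀ t, 1 ≤ t → t < N → b t + b' (t - 1) = 0) ∧
      (∀ t, 1 ≤ t → t < N → c t + c' (t - 1) = 0) ∧ ∀ t < N, ∀ w ∈ C t, e t w ≤ 0 := by
  refine ⟨fun τ hτ => eq_zero_of_apply_nonpos fun v => ?_,
    fun τ h1 hτ => eq_zero_of_apply_nonpos fun v => ?_,
    fun τ h1 hτ => eq_zero_of_apply_nonpos fun v => ?_, fun τ hτ w hw => ?_⟩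
  · have := h (Pi.single τ v) 0 0 0 rfl rfl rfl rfl hC
    simp only [Pi.zero_apply, map_zero, add_zero] at this
    rwa [Finset.sum_eq_single τ (fun t _ ht => by rw [Pi.single_eq_of_ne ht, map_zero])
      (fun h => absurd (Finset.mem_range.2 hτ) h), Pi.single_eq_same] at this
  · have := h 0 (Pi.single τ v) 0 0 (Pi.single_eq_of_ne (by omega) _)
      (Pi.single_eq_of_ne (by omega) _) rfl rfl hC
    simp only [Pi.zero_apply, map_zero, add_zero, zero_add] at this
    rwa [sum_apply_single_shift b b' v h1 hτ] at this
  · have := h 0 0 (Pi.single τ v) 0 rfl rfl (Pi.single_eq_of_ne (by omega) _)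
      (Pi.single_eq_of_ne (by omega) _) hC
    simp only [Pi.zero_apply, map_zero, add_zero, zero_add] at this
    rwa [sum_apply_single_shift c c' v h1 hτ] at this
  · have := h 0 0 0 (Pi.single τ w) rfl rfl rfl rfl (fun t ht => by
      rcases eq_or_ne t τ with rfl | hne
      · rwa [Pi.single_eq_same]
      · rw [Pi.single_eq_of_ne hne]; exact hC t ht)
    simp only [Pi.zero_apply, map_zero, zero_add] at this
    rwa [Finset.sum_eq_single τ (fun t _ ht => by rw [Pi.single_eq_of_ne ht, map_zero])
      (fun h => absurd (Finset.mem_range.2 hτ) h), Pi.single_eq_same] at this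

/-! ### Multipliers for the optimal control problem -/

/-- The blocks of a functional on `(A × B × C)ᴺ`, indexed by all natural numbers. -/
theorem exists_dual_components {N : ℕ} {A B C : Type*} [NormedAddCommGroup A] [NormedSpace ℝ A]
    [NormedAddCommGroup B] [NormedSpace ℝ B] [NormedAddCommGroup C] [NormedSpace ℝ C]
    (m : (Fin N → A × B × C) →L[ℝ] ℝ) :
    ∃ (μ : ℕ → A →L[ℝ] ℝ) (ζ : ℕ → B →L[ℝ] ℝ) (ξ : ℕ → C →L[ℝ] ℝ),
      ∀ y : ℕ → A × B × C, m (fun i => y i) =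
        ∑ t ∈ Finset.range N, (μ t (y t).1 + ζ t (y t).2.1 + ξ t (y t).2.2) := by
  let k : ℕ → (A × B × C) →L[ℝ] ℝ := fun t =>
    if h : t < N then m.comp (ContinuousLinearMap.single ℝ (fun _ : Fin N => A × B × C) ⟨t, h⟩)
    else 0
  refine ⟨fun t => (k t).comp (ContinuousLinearMap.inl ℝ A (B × C)),
    fun t => (k t).comp ((ContinuousLinearMap.inr ℝ A (B × C)).comp
      (ContinuousLinearMap.inl ℝ B C)),
    fun t => (k t).comp ((ContinuousLinearMap.inr ℝ A (B × C)).comp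
      (ContinuousLinearMap.inr ℝ B C)), fun y => ?_⟩
  have h1 : m (fun i => y i) = ∑ t ∈ Finset.range N, k t (y t) := by
    rw [← Fin.sum_univ_eq_sum_range (fun t => k t (y t)) N]
    conv_lhs => rw [← Finset.univ_sum_single (fun i : Fin N => y i), map_sum]
    refine Finset.sum_congr rfl fun i _ => ?_
    simp [k]
  rw [h1]
  refine Finset.sum_congr rfl fun t _ => ?_
  simp only [ContinuousLinearMap.comp_apply, ← map_add]
  simp

/-- Simultaneous variations of the integration steps, poses, states and controls at the times
`0, …, N - 1`, in this order; the end points are kept fixed by `Variation.pose` and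
`Variation.state`. -/
abbrev Variation (N d nx nu : ℕ) : Type := Fin N → RSp d × RSp d × RSp nx × RSp nu

namespace Variation

variable {N d nx nu : ℕ}

/-- The variation at time `t`, zero for `t ≥ N`. -/
def atTime (t : ℕ) : Variation N d nx nu →L[ℝ] RSp d × RSp d × RSp nx × RSp nu :=
  if h : t < N then ContinuousLinearMap.proj ⟨t, h⟩ else 0

/-- The variation of the integration step at time `t`. -/
def step (t : ℕ) : Variation N d nx nu →L[ℝ] RSp d :=
  (ContinuousLinearMap.fst ℝ _ _).comp (atTime t)

/-- The variation of the pose at time `t`, zero at both end points. -/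
def pose (t : ℕ) : Variation N d nx nu →L[ℝ] RSp d :=
  if t = 0 then 0 else
    ((ContinuousLinearMap.fst ℝ _ _).comp (ContinuousLinearMap.snd ℝ _ _)).comp (atTime t)

/-- The variation of the state in `ℝ^nx` at time `t`, zero at both end points. -/
def state (t : ℕ) : Variation N d nx nu →L[ℝ] RSp nx :=
  if t = 0 then 0 else ((ContinuousLinearMap.fst ℝ _ _).comp ((ContinuousLinearMap.snd ℝ _ _).comp
    (ContinuousLinearMap.snd ℝ _ _))).comp (atTime t)

/-- The variation of the control at time `t`. -/
def control (t : ℕ) : Variation N d nx nu →L[ℝ] RSp nu :=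
  ((ContinuousLinearMap.snd ℝ _ _).comp ((ContinuousLinearMap.snd ℝ _ _).comp
    (ContinuousLinearMap.snd ℝ _ _))).comp (atTime t)

theorem pose_zero (w : Variation N d nx nu) : pose 0 w = 0 := by simp [pose]

theorem state_zero (w : Variation N d nx nu) : state 0 w = 0 := by simp [state]

theorem pose_last (w : Variation N d nx nu) : pose N w = 0 := by
  rw [pose]; split_ifs <;> simp [atTime]

theorem state_last (w : Variation N d nx nu) : state N w = 0 := by
  rw [state]; split_ifs <;> simp [atTime]

/-- The variation with prescribed components. -/
def mk (σ y : ℕ → RSp d) (χ : ℕ → RSp nx) (η : ℕ → RSp nu) : Variation N d nx nu :=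
  fun i => (σ i, y i, χ i, η i)

variable {σ y : ℕ → RSp d} {χ : ℕ → RSp nx} {η : ℕ → RSp nu} {t : ℕ}

theorem step_mk (ht : t < N) : step t (mk σ y χ η : Variation N d nx nu) = σ t := by
  simp [step, atTime, ht, mk]

theorem control_mk (ht : t < N) : control t (mk σ y χ η : Variation N d nx nu) = η t := by
  simp [control, atTime, ht, mk]

theorem pose_mk (h0 : y 0 = 0) (hN : y N = 0) (ht : t ≤ N) :
    pose t (mk σ y χ η : Variation N d nx nu) = y t := by
  rcases ht.eq_or_lt with rfl | ht
  · rw [pose_last, hN]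
  rcases eq_or_ne t 0 with rfl | h
  · rw [pose_zero, h0]
  simp [pose, atTime, ht, mk, h]

theorem state_mk (h0 : χ 0 = 0) (hN : χ N = 0) (ht : t ≤ N) :
    state t (mk σ y χ η : Variation N d nx nu) = χ t := by
  rcases ht.eq_or_lt with rfl | ht
  · rw [state_last, hN]
  rcases eq_or_ne t 0 with rfl | h
  · rw [state_zero, h0]
  simp [state, atTime, ht, mk, h]

end Variation

namespace ImplicitProblem

variable {d nx nu : ℕ} {G : Type*} [TopologicalSpace G] [ChartedSpace (RSp d) G] [Group G]
  {P : ImplicitProblem d nx nu G} {s q : ℕ → G} {x : ℕ → RSp nx} {u : ℕ → RSp nu}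

theorem Assumptions.contMDiffAt_c (hP : P.Assumptions) {t : ℕ} (ht : t < P.N) {g : G}
    (hg : g ∈ P.Oe) (h : G) (y : RSp nx) (w : RSp nu) :
    ContMDiffAt ((𝓡 d).prod ((𝓡 d).prod ((𝓡 nx).prod (𝓡 nu)))) 𝓘(ℝ, ℝ) ∞
      (fun p : G × G × RSp nx × RSp nu => P.c t p.1 p.2.1 p.2.2.1 p.2.2.2) (g, h, y, w) :=
  (hP.smooth_c t ht).contMDiffAt ((hP.isOpen_Oe.prod isOpen_univ).mem_nhds ⟨hg, trivial⟩)

theorem Assumptions.contMDiffAt_f (hP : P.Assumptions) {t : ℕ} (ht : t < P.N) {g : G}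
    (hg : g ∈ P.Oe) (h : G) (y : RSp nx) (w : RSp nu) :
    ContMDiffAt ((𝓡 d).prod ((𝓡 d).prod ((𝓡 nx).prod (𝓡 nu)))) (𝓡 nx) ∞
      (fun p : G × G × RSp nx × RSp nu => P.f t p.1 p.2.1 p.2.2.1 p.2.2.2) (g, h, y, w) :=
  (hP.smooth_f t ht).contMDiffAt ((hP.isOpen_Oe.prod isOpen_univ).mem_nhds ⟨hg, trivial⟩)

theorem Assumptions.contMDiffAt_v (hP : P.Assumptions) {t : ℕ} (ht : t < P.N) {g : G}
    (hg : g ∈ P.Oe) (h : G) (y : RSp nx) (w : RSp nu) :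
    ContMDiffAt ((𝓡 d).prod ((𝓡 d).prod ((𝓡 nx).prod (𝓡 nu)))) (𝓡 d) ∞
      (fun p : G × G × RSp nx × RSp nu => P.v t p.1 p.2.1 p.2.2.1) (g, h, y, w) := by
  have h1 := (hP.smooth_v t ht).contMDiffAt (x := (g, h, y))
    ((hP.isOpen_Oe.prod isOpen_univ).mem_nhds ⟨hg, trivial⟩)
  have h2 : ContMDiffAt ((𝓡 d).prod ((𝓡 d).prod ((𝓡 nx).prod (𝓡 nu))))
      ((𝓡 d).prod ((𝓡 d).prod (𝓡 nx))) ∞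
      (fun p : G × G × RSp nx × RSp nu => (p.1, p.2.1, p.2.2.1)) (g, h, y, w) :=
    contMDiffAt_fst.prodMk (contMDiffAt_snd.fst.prodMk contMDiffAt_snd.snd.fst)
  exact ContMDiffAt.comp_of_eq (x := (g, h, y, w)) h1 h2 rfl

theorem Assumptions.contMDiffAt_lieLog (hP : P.Assumptions) {g : G}
    (hg : g ∈ (lieExp : RSp d → G) '' P.O) (h : G) (y : RSp nx) (w : RSp nu) :
    ContMDiffAt ((𝓡 d).prod ((𝓡 d).prod ((𝓡 nx).prod (𝓡 nu)))) (𝓡 d) ∞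
      (fun p : G × G × RSp nx × RSp nu => lieLog P.O p.1) (g, h, y, w) :=
  ContMDiffAt.comp_of_eq (x := (g, h, y, w)) (hP.exp_diffeo.contMDiffAt_lieLog hg)
    contMDiffAt_fst rfl

theorem Assumptions.contMDiffAt_ham (hP : P.Assumptions) (ν : ℝ) {t : ℕ} (ht : t < P.N)
    (ζ : RSp d →L[ℝ] ℝ) (ξ : RSp nx →L[ℝ] ℝ) {g : G}
    (hg : g ∈ P.Oe) (hg' : g ∈ (lieExp : RSp d → G) '' P.O) (h : G) (y : RSp nx) (w : RSp nu) :
    ContMDiffAt ((𝓡 d).prod ((𝓡 d).prod ((𝓡 nx).prod (𝓡 nu)))) 𝓘(ℝ, ℝ) ∞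
      (fun p : G × G × RSp nx × RSp nu => P.ham ν t ζ ξ p.1 p.2.1 p.2.2.1 p.2.2.2)
      (g, h, y, w) := by
  have hζ := ContMDiffAt.comp (g, h, y, w) (ζ.contMDiff.contMDiffAt (n := ∞))
    (hP.contMDiffAt_lieLog hg' h y w)
  have hξ := ContMDiffAt.comp (g, h, y, w) (ξ.contMDiff.contMDiffAt (n := ∞))
    (hP.contMDiffAt_f ht hg h y w)
  exact ((contMDiffAt_const.mul (hP.contMDiffAt_c ht hg h y w)).add hζ).add hξ

variable [LieGroup (𝓡 d) ∞ G]

/-- Derivative of the stage Lagrangian: the Hamiltonian, with the constraint `v_t = 0` adjoined by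
`μ` and the terms in which the next pose and state enter the dynamics. -/
theorem Assumptions.hasFDerivAt_lagrangian (hP : P.Assumptions) (ν : ℝ) {t : ℕ} (ht : t < P.N)
    (μ ζ : RSp d →L[ℝ] ℝ) (ξ : RSp nx →L[ℝ] ℝ) {g h h' : G} (hg : g ∈ P.Oe)
    (hg' : g ∈ (lieExp : RSp d → G) '' P.O) (hh : h' = h * g) (y y' : RSp nx) (v : RSp nu)
    {κ : RSp d → G} (hκ1 : κ 0 = 1)
    (hκ : HasMFDerivAt (𝓡 d) (𝓡 d) κ 0 (ContinuousLinearMap.id ℝ (RSp d)))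
    {E : Type*} [NormedAddCommGroup E] [NormedSpace ℝ E]
    (S Y Y' : E →L[ℝ] RSp d) (A A' : E →L[ℝ] RSp nx) (B : E →L[ℝ] RSp nu) :
    HasFDerivAt (fun w => P.ham ν t ζ ξ (g * κ (S w)) (h * κ (Y w)) (y + A w) (v + B w) +
        μ (P.v t (g * κ (S w)) (h * κ (Y w)) (y + A w)) -
        ζ (lieLog P.O ((h * κ (Y w))⁻¹ * (h' * κ (Y' w)))) - ξ (y' + A' w))
      (((P.hamS ν t ζ ξ g h y v + μ.comp (P.vS t g h y)).comp (tangentLeft g)).comp S +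
        (((P.hamQ ν t ζ ξ g h y v + μ.comp (P.vQ t g h y)).comp (tangentLeft h) +
          ζ.comp ((dLog P.O g).comp (lieAd g⁻¹))).comp Y + (-(ζ.comp (dLog P.O g))).comp Y') +
        ((P.hamX ν t ζ ξ g h y v + μ.comp (P.vX t g h y)).comp A + (-ξ).comp A') +
        (P.hamU ν t ζ ξ g h y v).comp B) 0 := by
  have d1 := hasFDerivAt_perturbed hκ1 (hP.contMDiffAt_ham ν ht ζ ξ hg hg' h y v) hκ S Y A B
  have d2 := μ.hasFDerivAt.comp (0 : E) (hasFDerivAt_perturbed (F := fun a b y _ => P.v t a b y) hκ1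
    (hP.contMDiffAt_v ht hg h y v) hκ S Y A B)
  have d3 := ζ.hasFDerivAt.comp (0 : E) (hasFDerivAt_lieLog_perturbed hκ1 hh
    (hP.exp_diffeo.contMDiffAt_lieLog hg') hκ Y Y')
  have d4 := ξ.hasFDerivAt.comp (0 : E) (A'.hasFDerivAt.const_add y')
  refine (((d1.add d2).sub d3).sub d4).congr_fderiv (ContinuousLinearMap.ext fun w => ?_)
  have e : fderiv ℝ (fun _ : RSp nu => P.v t g h y) v = 0 := by simp
  simp only [hamS, hamQ, hamX, hamU, vS, vQ, vX, add_apply, sub_apply, neg_apply, e,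
    ContinuousLinearMap.comp_apply, map_add, map_neg, zero_apply, map_zero]
  ring

open Variation in
/-- First-order condition for the problem in which integration steps, poses, states and controls
are independent variables, and the dynamics, in the form `v_t = 0`,
`exp⁻¹ s_t = exp⁻¹ (q_t⁻¹ q_{t+1})` and `f_t = x_{t+1}`, are equality constraints with multipliers
`μ_t`, `ζ_t` and `ξ_t`. -/
theorem IsOptimal.exists_multipliers (hP : P.Assumptions) (hopt : P.IsOptimal s q x u) :
    ∃ (ν : ℝ) (μ ζ : ℕ → RSp d →L[ℝ] ℝ) (ξ : ℕ → RSp nx →L[ℝ] ℝ), (ν = -1 ∨ ν = 0) ∧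
      ¬ (ν = 0 ∧ ∀ t < P.N, μ t = 0 ∧ ζ t = 0 ∧ ξ t = 0) ∧
      ∀ w : Variation P.N d nx nu, (∀ t < P.N, u t + control t w ∈ P.U t) →
        ∑ t ∈ Finset.range P.N,
          (((P.hamS ν t (ζ t) (ξ t) (s t) (q t) (x t) (u t) +
              (μ t).comp (P.vS t (s t) (q t) (x t))).comp (tangentLeft (s t))) (step t w) +
            (((P.hamQ ν t (ζ t) (ξ t) (s t) (q t) (x t) (u t) +
                (μ t).comp (P.vQ t (s t) (q t) (x t))).comp (tangentLeft (q t)) +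
              (ζ t).comp ((dLog P.O (s t)).comp (lieAd (s t)⁻¹))) (pose t w) +
              (-((ζ t).comp (dLog P.O (s t)))) (pose (t + 1) w)) +
            ((P.hamX ν t (ζ t) (ξ t) (s t) (q t) (x t) (u t) +
                (μ t).comp (P.vX t (s t) (q t) (x t))) (state t w) +
              (-ξ t) (state (t + 1) w)) +
            P.hamU ν t (ζ t) (ξ t) (s t) (q t) (x t) (u t) (control t w)) ≤ 0 := by
  have hG : IsTopologicalGroup G := topologicalGroup_of_lieGroup (𝓡 d) ∞
  obtain ⟨hf, hmin⟩ := hopt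
  obtain ⟨κ, hκ1, hκs, hκd⟩ := exists_param_near_one d G
  have hlog : ∀ t < P.N, ContMDiffAt (𝓡 d) (𝓡 d) ∞ (lieLog P.O) (s t) := fun t ht =>
    hP.exp_diffeo.contMDiffAt_lieLog (hf.step_mem_exp t ht)
  let s' : Variation P.N d nx nu → ℕ → G := fun w t => s t * κ (step t w)
  let q' : Variation P.N d nx nu → ℕ → G := fun w t => q t * κ (pose t w)
  let x' : Variation P.N d nx nu → ℕ → RSp nx := fun w t => x t + state t w
  let u' : Variation P.N d nx nu → ℕ → RSp nu := fun w t => u t + control t w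
  have hs0 : s' 0 = s := by funext t; simp [s', hκ1]
  have hq0 : q' 0 = q := by funext t; simp [q', hκ1]
  have hx0 : x' 0 = x := by funext t; simp [x']
  have hu0 : u' 0 = u := by funext t; simp [u']
  let J : Variation P.N d nx nu → ℝ := fun w => P.cost (s' w) (q' w) (x' w) (u' w)
  let R : Variation P.N d nx nu → ℕ → RSp d × RSp d × RSp nx := fun w t =>
    (P.v t (s' w t) (q' w t) (x' w t),
      lieLog P.O (s' w t) - lieLog P.O ((q' w t)⁻¹ * q' w (t + 1)),
      P.f t (s' w t) (q' w t) (x' w t) (u' w t) - x' w (t + 1))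
  let F : Variation P.N d nx nu → Fin P.N → RSp d × RSp d × RSp nx := fun w i => R w i
  have hR0 : ∀ t < P.N, R 0 t = 0 := by
    intro t ht
    simp only [R, hs0, hq0, hx0, hu0, hf.step_eq t ht, hf.q_succ t ht, hf.x_succ t ht,
      inv_mul_cancel_left, sub_self]
    rfl
  have hJs : ContDiffAt ℝ ∞ J 0 := by
    refine ContDiffAt.sum fun t ht => ?_
    have ht := Finset.mem_range.1 ht
    exact contDiffAt_perturbed hκ1 (hP.contMDiffAt_c ht (hf.step_mem t ht) _ _ _) hκs _ _ _ _
  have hRs : ∀ t < P.N, ContDiffAt ℝ ∞ (fun w => R w t) 0 := by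
    intro t ht
    refine ContDiffAt.prodMk ?_ (ContDiffAt.prodMk (ContDiffAt.sub ?_ ?_) (ContDiffAt.sub ?_ ?_))
    · exact contDiffAt_perturbed (F := fun a b y _ => P.v t a b y) hκ1
        (hP.contMDiffAt_v ht (hf.step_mem t ht) _ _ (u t)) hκs _ _ _ (control t)
    · exact contDiffAt_perturbed (F := fun a _ _ _ => lieLog P.O a) hκ1
        (hP.contMDiffAt_lieLog (hf.step_mem_exp t ht) (q t) (x t) (u t)) hκs _ (pose t) (state t)
        (control t)
    · exact contDiffAt_lieLog_perturbed hκ1 (hf.q_succ t ht) (hlog t ht) hκs _ _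
    · exact contDiffAt_perturbed hκ1 (hP.contMDiffAt_f ht (hf.step_mem t ht) _ _ _) hκs _ _ _ _
    · exact contDiffAt_const.add (state (t + 1)).contDiff.contDiffAt
  have hFs : ContDiffAt ℝ ∞ F 0 := contDiffAt_pi.2 fun i => hRs i i.2
  have hJd := hJs.hasStrictFDerivAt (by simp)
  have hFd := hFs.hasStrictFDerivAt (by simp)
  let C : Set (Variation P.N d nx nu) := {w | ∀ t < P.N, u t + control t w ∈ P.U t}
  have hC : Convex ℝ C := by
    have : C = ⋂ t, ⋂ (_ : t < P.N), (fun w => u t + control t w) ⁻¹' P.U t := by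
      ext w; simp [C]
    rw [this]
    exact convex_iInter₂ fun t ht => ((hP.convex_U t ht).translate_preimage_right
      (u t)).is_linear_preimage (control t).toLinearMap.isLinear
  have hC0 : (0 : Variation P.N d nx nu) ∈ C := fun t ht => by
    simpa using hf.control t ht
  have hnear : ∀ᶠ w in 𝓝 (0 : Variation P.N d nx nu), ∀ i : Fin P.N,
      s' w i ∈ P.Oe ∧ s' w i ∈ (lieExp : RSp d → G) '' P.O ∧
        (q' w i)⁻¹ * q' w (i + 1) ∈ (lieExp : RSp d → G) '' P.O := by
    rw [eventually_all]
    rintro ⟨t, ht⟩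
    have c1 : ContinuousAt (fun w => s' w t) 0 :=
      (contMDiffAt_mul_param hκs (s t) (step t)).continuousAt
    have c2 : ∀ τ, ContinuousAt (fun w => q' w τ) 0 := fun τ =>
      (contMDiffAt_mul_param hκs (q τ) (pose τ)).continuousAt
    have c3 : ContinuousAt (fun w => (q' w t)⁻¹ * q' w (t + 1)) 0 := (c2 t).inv.mul (c2 (t + 1))
    have o := hP.exp_diffeo.2.1
    refine (c1.eventually_mem (hP.isOpen_Oe.mem_nhds ?_)).and
      ((c1.eventually_mem (o.mem_nhds ?_)).and (c3.eventually_mem (o.mem_nhds ?_)))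
    · rw [hs0]; exact hf.step_mem t ht
    · rw [hs0]; exact hf.step_mem_exp t ht
    · rw [hq0, hf.q_succ t ht, inv_mul_cancel_left]; exact hf.step_mem_exp t ht
  have hlocal : ∀ᶠ w in 𝓝 (0 : Variation P.N d nx nu), w ∈ C → F w = F 0 → J 0 ≤ J w := by
    filter_upwards [hnear] with w hw hwC hwF
    have hR : ∀ t < P.N, R w t = 0 := fun t ht => (congrFun hwF ⟨t, ht⟩).trans (hR0 t ht)
    have hfeas : P.Feasible (s' w) (q' w) (x' w) (u' w) := by
      refine ⟨fun t ht => (hw ⟨t, ht⟩).1, fun t ht => (hw ⟨t, ht⟩).2.1,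
        fun t ht => congrArg Prod.fst (hR t ht), fun t ht => ?_, fun t ht => ?_, hwC, ?_, ?_, ?_, ?_⟩
      · -- the logarithm is injective on `exp O`
        have h1 := sub_eq_zero.1 (congrArg (fun p => p.2.1) (hR t ht))
        rw [lieLog_injOn P.O (hw ⟨t, ht⟩).2.1 (hw ⟨t, ht⟩).2.2 h1, mul_inv_cancel_left]
      · exact (sub_eq_zero.1 (congrArg (fun p => p.2.2) (hR t ht))).symm
      · simp [q', pose_zero, hκ1, hf.q_init]
      · simp [x', state_zero, hf.x_init]
      · simp [q', pose_last, hκ1, hf.q_fin]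
      · simp [x', state_last, hf.x_fin]
    have := hmin _ _ _ _ hfeas
    simpa only [J, hs0, hq0, hx0, hu0] using this
  obtain ⟨ν, m, hν, hne, hineq⟩ := exists_multiplier_of_eventually_min hJd hFd hC hC0 hlocal
  obtain ⟨μ, ζ, ξ, hm⟩ := exists_dual_components m
  refine ⟨ν, μ, ζ, ξ, hν, ?_, ?_⟩
  · rintro ⟨h0, hz⟩
    refine hne ⟨h0, ContinuousLinearMap.ext fun y => ?_⟩
    have := hm (fun t => if h : t < P.N then y ⟨t, h⟩ else 0)
    simp only [Fin.is_lt, dite_true] at this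
    rw [zero_apply, this]
    refine Finset.sum_eq_zero fun t ht => ?_
    obtain ⟨h1, h2, h3⟩ := hz t (Finset.mem_range.1 ht)
    simp [h1, h2, h3]
  · intro w hw
    have hL1 := (hJd.hasFDerivAt.const_mul ν).add (m.hasFDerivAt.comp 0 hFd.hasFDerivAt)
    have hL2 := HasFDerivAt.fun_sum (u := Finset.range P.N) fun t ht =>
      hP.hasFDerivAt_lagrangian (E := Variation P.N d nx nu) ν (Finset.mem_range.1 ht)
        (μ t) (ζ t) (ξ t)
        (hf.step_mem t (Finset.mem_range.1 ht)) (hf.step_mem_exp t (Finset.mem_range.1 ht))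
        (hf.q_succ t (Finset.mem_range.1 ht)) (x t) (x (t + 1)) (u t) hκ1 hκd (step t) (pose t)
        (pose (t + 1)) (state t) (state (t + 1)) (control t)
    have he := hL1.unique (hL2.congr_of_eventuallyEq (Eventually.of_forall fun w => ?_))
    · have h1 := hineq w hw
      have h2 := DFunLike.congr_fun he w
      refine le_trans (le_of_eq ?_) h1
      refine Eq.trans ?_ h2.symm
      rw [sum_apply]
      rfl
    · have h1 : m (F w) = _ := hm (R w)
      change ν * J w + m (F w) = _
      rw [h1]
      simp only [J, cost, Finset.mul_sum, ← Finset.sum_add_distrib]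
      refine Finset.sum_congr rfl fun t ht => ?_
      simp only [R, ham, map_sub, s', q', x', u']
      ring

end ImplicitProblem

namespace ImplicitProblem

variable {d nx nu : ℕ} {G : Type*} [TopologicalSpace G] [ChartedSpace (RSp d) G] [Group G]
  {P : ImplicitProblem d nx nu G}

theorem hamZeta_eq (ν : ℝ) (t : ℕ) (ζ : RSp d →L[ℝ] ℝ) (ξ : RSp nx →L[ℝ] ℝ) (s q : G)
    (x : RSp nx) (u : RSp nu) : P.hamZeta ν t ζ ξ s q x u = lieLog P.O s :=
  dualGradient_eq (a := ν * P.c t s q x u + ξ (P.f t s q x u)) (fun p => by rw [ham]; ring) ζ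

theorem hamXi_eq (ν : ℝ) (t : ℕ) (ζ : RSp d →L[ℝ] ℝ) (ξ : RSp nx →L[ℝ] ℝ) (s q : G)
    (x : RSp nx) (u : RSp nu) : P.hamXi ν t ζ ξ s q x u = P.f t s q x u :=
  dualGradient_eq (a := ν * P.c t s q x u + ζ (lieLog P.O s)) (fun p => by rw [ham]) ξ

end ImplicitProblem

end

theorem corollary3 {d nx nu : ℕ} {G : Type*} [TopologicalSpace G] [T2Space G]
    [ChartedSpace (RSp d) G] [Group G] [LieGroup (𝓡 d) ∞ G]
    (P : ImplicitProblem d nx nu G) (hP : P.Assumptions)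
    (s q : ℕ → G) (x : ℕ → RSp nx) (u : ℕ → RSp nu) (hopt : P.IsOptimal s q x u) :
    ∃ (ν : ℝ) (ζ : ℕ → (RSp d →L[ℝ] ℝ)) (ξ : ℕ → (RSp nx →L[ℝ] ℝ)),
      (ν = -1 ∨ ν = 0) ∧
      -- state dynamics
      (∀ t < P.N,
        q (t + 1) = q t * lieExp (P.hamZeta ν t (ζ t) (ξ t) (s t) (q t) (x t) (u t)) ∧
        P.v t (s t) (q t) (x t) = 0 ∧
        x (t + 1) = P.hamXi ν t (ζ t) (ξ t) (s t) (q t) (x t) (u t)) ∧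
      -- adjoint dynamics
      (∀ t, 1 ≤ t → t < P.N →
        P.rho ν (t - 1) (ζ (t - 1)) (ξ (t - 1)) (s (t - 1)) (q (t - 1)) (x (t - 1)) (u (t - 1)) =
          (P.rho ν t (ζ t) (ξ t) (s t) (q t) (x t) (u t)).comp
              (lieAd (lieExp (-P.hamZeta ν t (ζ t) (ξ t) (s t) (q t) (x t) (u t)) : G))
            + (P.hamQ ν t (ζ t) (ξ t) (s t) (q t) (x t) (u t)).comp (tangentLeft (q t))
            - ((P.hamS ν t (ζ t) (ξ t) (s t) (q t) (x t) (u t)).comp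
                ((P.vS t (s t) (q t) (x t)).inverse.comp
                  (P.vQ t (s t) (q t) (x t)))).comp (tangentLeft (q t)) ∧
        ξ (t - 1) =
          -((P.hamS ν t (ζ t) (ξ t) (s t) (q t) (x t) (u t)).comp
              ((P.vS t (s t) (q t) (x t)).inverse.comp (P.vX t (s t) (q t) (x t))))
            + P.hamX ν t (ζ t) (ξ t) (s t) (q t) (x t) (u t)) ∧
      -- Hamiltonian non-positive gradient condition
      (∀ t < P.N, ∀ w ∈ P.U t,
        P.hamU ν t (ζ t) (ξ t) (s t) (q t) (x t) (u t) (w - u t) ≤ 0) ∧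
      -- non-triviality
      ¬ (ν = 0 ∧ ∀ t < P.N, ζ t = 0 ∧ ξ t = 0) := by
  have hf := hopt.1
  obtain ⟨ν, μ, ζ, ξ, hν, hne, hineq⟩ := hopt.exists_multipliers hP
  obtain ⟨hS, hQ, hX, hU⟩ := stage_conditions
    (fun t => (P.hamS ν t (ζ t) (ξ t) (s t) (q t) (x t) (u t) +
      (μ t).comp (P.vS t (s t) (q t) (x t))).comp (tangentLeft (s t)))
    (fun t => (P.hamQ ν t (ζ t) (ξ t) (s t) (q t) (x t) (u t) +
      (μ t).comp (P.vQ t (s t) (q t) (x t))).comp (tangentLeft (q t)) +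
        (ζ t).comp ((dLog P.O (s t)).comp (lieAd (s t)⁻¹)))
    (fun t => -((ζ t).comp (dLog P.O (s t))))
    (fun t => P.hamX ν t (ζ t) (ξ t) (s t) (q t) (x t) (u t) +
      (μ t).comp (P.vX t (s t) (q t) (x t)))
    (fun t => -ξ t)
    (fun t => P.hamU ν t (ζ t) (ξ t) (s t) (q t) (x t) (u t))
    (N := P.N) (C := fun t => {w | u t + w ∈ P.U t})
    (fun t ht => by simpa using hf.control t ht)
    (fun σ y χ η hy0 hyN hχ0 hχN hη => by
      have h := hineq (Variation.mk σ y χ η) fun t ht => by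
        rw [Variation.control_mk ht]; exact hη t ht
      refine le_trans (le_of_eq (Finset.sum_congr rfl fun t ht => ?_)) h
      have ht := Finset.mem_range.1 ht
      rw [Variation.step_mk ht, Variation.control_mk ht, Variation.pose_mk hy0 hyN ht.le,
        Variation.pose_mk hy0 hyN ht, Variation.state_mk hχ0 hχN ht.le,
        Variation.state_mk hχ0 hχN ht])
  have hinv : ∀ t < P.N, (P.vS t (s t) (q t) (x t)).IsInvertible := fun t ht =>
    (hP.v_diffeo s q x u hf t ht).isInvertible_groupDeriv (hf.step_mem t ht)
  have hS' : ∀ t < P.N, P.hamS ν t (ζ t) (ξ t) (s t) (q t) (x t) (u t) =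
      -(μ t).comp (P.vS t (s t) (q t) (x t)) := by
    intro t ht
    refine eq_neg_of_add_eq_zero_left (ContinuousLinearMap.ext fun z => ?_)
    obtain ⟨y, rfl⟩ := (isInvertible_tangentLeft (d := d) (s t)).surjective z
    exact DFunLike.congr_fun (hS t ht) y
  have hμ : ∀ t < P.N, ∀ z, P.hamS ν t (ζ t) (ξ t) (s t) (q t) (x t) (u t)
      ((P.vS t (s t) (q t) (x t)).inverse z) = -μ t z := by
    intro t ht z
    rw [hS' t ht]
    simp [(hinv t ht).self_apply_inverse]
  have hlog : ∀ t < P.N, (lieExp (lieLog P.O (s t)) : G) = s t := fun t ht =>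
    lieExp_lieLog (hf.step_mem_exp t ht)
  refine ⟨ν, ζ, ξ, hν, fun t ht => ?_, fun t h1 ht => ⟨?_, ?_⟩, fun t ht w hw => ?_, ?_⟩
  · rw [ImplicitProblem.hamZeta_eq, ImplicitProblem.hamXi_eq, hlog t ht]
    exact ⟨hf.q_succ t ht, hf.step_eq t ht, hf.x_succ t ht⟩
  · simp only [ImplicitProblem.rho, ImplicitProblem.hamZeta_eq, lieExp_neg, hlog t ht,
      hlog (t - 1) (by omega)]
    refine ContinuousLinearMap.ext fun z => ?_
    have h2 := DFunLike.congr_fun (hQ t h1 ht) z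
    simp only [add_apply, neg_apply, sub_apply, ContinuousLinearMap.comp_apply, zero_apply] at h2 ⊢
    rw [hμ t ht]
    linarith
  · refine ContinuousLinearMap.ext fun z => ?_
    have h2 := DFunLike.congr_fun (hX t h1 ht) z
    simp only [add_apply, neg_apply, ContinuousLinearMap.comp_apply, zero_apply] at h2 ⊢
    rw [hμ t ht]
    linarith
  · exact hU t ht _ (by simpa using hw)
  · rintro ⟨h0, hz⟩
    refine hne ⟨h0, fun t ht => ⟨?_, hz t ht⟩⟩
    -- the Hamiltonian vanishes identically, so `μ t` is annihilated by the invertible `D_s v_t`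
    have hham : P.hamS ν t (ζ t) (ξ t) (s t) (q t) (x t) (u t) = 0 := by
      have : (fun s' => P.ham ν t (ζ t) (ξ t) s' (q t) (x t) (u t)) = fun _ => 0 := by
        funext s'
        simp [ImplicitProblem.ham, h0, (hz t ht).1, (hz t ht).2]
      rw [ImplicitProblem.hamS, this]
      exact mfderiv_const
    refine ContinuousLinearMap.ext fun z => ?_
    have := hμ t ht z
    rw [hham] at this
    simpa using this.symm
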